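/- **Setting.** Let $\mathbf T^2=\mathbf R^2/\mathbf Z^2$. Let $\rho\in\mathcal C^\infty(\mathbf R^2)$ be nonnegative and even with $\operatorname{supp}\rho\subset(-\tfrac12,\tfrac12)^2$ and $\int_{\mathbf R^2}\rho=1$. For $\varepsilon\in(0,1)$ put $\rho^\varepsilon(x)=\varepsilon^{-2}\rho(\varepsilon^{-1}x)$, regarded as a function on $\mathbf T^2$ by periodic extension. Let $W$ be a cylindrical Wiener process on $L^2(\mathbf T^2)$ with identity covariance operator, defined on a probability space with expectation $\mathbf E$, and let $W^\varepsilon=\rho^\varepsilon*W$, i.e. $W^\varepsilon(t,x)=W_t(\rho^\varepsilon(x-\cdot))$. For $\theta\ge 0$ let $\widetilde h^\varepsilon_\theta$ be a solution on $[0,\infty)\times\mathbf T^2$ of $$\partial_t\widetilde h^\varepsilon_\theta=\tfrac12\Delta\widetilde h^\varepsilon_\theta+\tfrac12|\log\varepsilon|^{-1/2}|\nabla\widetilde h^\varepsilon_\theta|^2+\sqrt\theta\,\dot W^\varepsilon,\qquad \widetilde h^\varepsilon_\theta(0,\cdot)=0,$$ meaning that $\widetilde h^\varepsilon_\theta$ is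 a random field which almost surely is twice continuously differentiable in $x$, with $\widetilde h^\varepsilon_\theta$ and its spatial derivatives up to order two continuous on $[0,\infty)\times\mathbf T^2$, and that for all $t\ge0$ and $x\in\mathbf T^2$, almost surely, $$\widetilde h^\varepsilon_\theta(t,x)=\int_0^t\Bigl(\tfrac12\Delta\widetilde h^\varepsilon_\theta+\tfrac12|\log\varepsilon|^{-1/2}|\nabla\widetilde h^\varepsilon_\theta|^2\Bigr)(s,x)\,\mathrm ds+\sqrt\theta\,W^\varepsilon(t,x).$$ **Lemma 6.4.** There is an absolute constant $\theta_0>0$ such that the following holds whenever $0\le\theta\le\theta_0$. For all $\varepsilon\in(0,1)$ and $t\ge0$, the random variable $\widetilde h^\varepsilon_\theta(t,x)$ is integrable for every $x\in\mathbf T^2$ and its expectation $$\kappa^\varepsilon_\theta(t)=\mathbf E\,\widetilde h^\varepsilon_\theta(t,x)$$ does not depend on $x$; and for each fixed $t\ge0$, as $\varepsilon\downarrow0$, $$\kappa^\varepsilon_\theta(t)=\frac12|\log\varepsilon|^{-1/2}\,\frac{\theta t}{\varepsilon^{2}}\,\|\rho\|^2_{L^2(\mathbf R^2)}+O\bigl(|\log\varepsilon|^{1/2}\bigr),$$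 where the implied constant may depend on $\rho$, $\theta$ and $t$. -/

import Mathlib

open MeasureTheory ProbabilityTheory
open scoped NNReal Laplacian Gradient Asymptotics

noncomputable section

namespace KPZ

/-- The plane `ℝ²` with its Euclidean structure. -/
abbrev Plane : Type := EuclideanSpace ℝ (Fin 2)

/-- The torus `𝕋² = ℝ² / ℤ²`. Its `volume` is the Lebesgue (Haar probability) measure. -/
abbrev Torus : Type := UnitAddTorus (Fin 2)

/-- The quotient map `ℝ² → 𝕋²`. -/
def toTorus (z : Plane) : Torus := fun i => (z i : UnitAddCircle)

/-- The representative of a point of the torus in the cell `(-1/2, 1/2]²`. -/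
def cellRep (y : Torus) : Plane :=
  WithLp.toLp 2 fun i => ((AddCircle.equivIoc (1 : ℝ) (-1 / 2) (y i) : Set.Ioc _ _) : ℝ)

/-- A mollifier: a smooth nonnegative even function on `ℝ²` with (closed) support in the open
square `(-1/2, 1/2)²` and integral one. -/
structure Mollifier where
  toFun : Plane → ℝ
  smooth : ContDiff ℝ ((⊤ : ℕ∞) : WithTop ℕ∞) toFun
  nonneg : ∀ x, 0 ≤ toFun x
  even : ∀ x, toFun (-x) = toFun x
  support_subset : tsupport toFun ⊆ {x | ∀ i, x i ∈ Set.Ioo (-(1 / 2) : ℝ) (1 / 2)}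
  integral_eq_one : ∫ x, toFun x = 1

/-- `ρ^ε(x) = ε⁻² ρ(ε⁻¹ x)` on `ℝ²`. -/
def Mollifier.scaled (ρ : Mollifier) (ε : ℝ) (x : Plane) : ℝ :=
  (ε ^ 2)⁻¹ * ρ.toFun (ε⁻¹ • x)

/-- `ρ^ε` as a function on the torus: the periodic extension of its restriction to the
cell `(-1/2, 1/2]²`, which contains its support when `0 < ε < 1`. -/
def Mollifier.onTorus (ρ : Mollifier) (ε : ℝ) (y : Torus) : ℝ :=
  ρ.scaled ε (cellRep y)

theorem measurable_cellRep : Measurable cellRep := by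
  unfold cellRep
  refine (WithLp.measurable_toLp 2 (Fin 2 → ℝ)).comp (measurable_pi_lambda _ fun i => ?_)
  exact measurable_subtype_coe.comp
    ((AddCircle.measurableEquivIoc (1 : ℝ) (-1 / 2)).measurable.comp (measurable_pi_apply i))

theorem Mollifier.memLp_shift (ρ : Mollifier) (ε : ℝ) (x : Torus) :
    MemLp (fun y : Torus => ρ.onTorus ε (x - y)) 2 volume := by
  have hcs : HasCompactSupport ρ.toFun := by
    refine HasCompactSupport.intro (isCompact_closedBall (0 : Plane) 1) fun z hz => ?_
    by_contra h
    apply hz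
    have hb := ρ.support_subset (subset_tsupport _ h)
    have h0 := hb 0
    have h1 := hb 1
    simp only [Set.mem_Ioo] at h0 h1
    rw [mem_closedBall_zero_iff, EuclideanSpace.norm_eq, Real.sqrt_le_left (by norm_num), one_pow]
    simp only [Fin.sum_univ_two, Real.norm_eq_abs, sq_abs]
    nlinarith [h0.1, h0.2, h1.1, h1.2]
  obtain ⟨C, hC⟩ := hcs.exists_bound_of_continuous ρ.smooth.continuous
  refine MemLp.of_bound (C := ‖(ε ^ 2)⁻¹‖ * C) ?_ (Filter.Eventually.of_forall fun y => ?_)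
  · refine Measurable.aestronglyMeasurable ?_
    have h1 : Measurable fun y : Torus => cellRep (x - y) :=
      measurable_cellRep.comp (by fun_prop)
    exact (ρ.smooth.continuous.measurable.comp (h1.const_smul ε⁻¹)).const_mul _
  · rw [Mollifier.onTorus, Mollifier.scaled, norm_mul]
    exact mul_le_mul_of_nonneg_left (hC _) (norm_nonneg _)

/-- The function `y ↦ ρ^ε(x - y)` as an element of `L²(𝕋²)`. -/
def Mollifier.shiftL2 (ρ : Mollifier) (ε : ℝ) (x : Torus) : Lp ℝ 2 (volume : Measure Torus) :=
  (ρ.memLp_shift ε x).toLp _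

variable {Ω : Type*} [MeasurableSpace Ω]

/-- `W` is a cylindrical Wiener process on `L²(𝕋²)` with identity covariance operator: a centred
Gaussian family indexed by `[0, ∞) × L²(𝕋²)` with
`𝐄 [W_s(f) W_t(g)] = min(s, t) ⟨f, g⟩`, such that each `t ↦ W_t(f)` is almost surely continuous. -/
structure IsCylindricalWiener (W : ℝ≥0 → Lp ℝ 2 (volume : Measure Torus) → Ω → ℝ)
    (P : Measure Ω) : Prop where
  gaussian : IsGaussianProcess
    (fun p : ℝ≥0 × Lp ℝ 2 (volume : Measure Torus) => W p.1 p.2) P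
  centered : ∀ t f, ∫ ω, W t f ω ∂P = 0
  covariance : ∀ s t f g, ∫ ω, W s f ω * W t g ω ∂P = min (s : ℝ) t * inner ℝ f g
  continuous_paths : ∀ f, ∀ᵐ ω ∂P, Continuous fun t => W t f ω

/-- The mollified noise `W^ε(t, x) = (ρ^ε * W_t)(x)`. -/
def mollifiedNoise (ρ : Mollifier) (W : ℝ≥0 → Lp ℝ 2 (volume : Measure Torus) → Ω → ℝ)
    (ε : ℝ) (t : ℝ≥0) (x : Torus) (ω : Ω) : ℝ :=
  W t (ρ.shiftL2 ε x) ω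

/-- The `ℤ²`-periodic function on `ℝ²` corresponding to a function on the torus. -/
def lift (f : Torus → ℝ) : Plane → ℝ := fun z => f (toTorus z)

/-- The right-hand side `½ Δf + ½ |log ε|^{-1/2} |∇f|²`, without the noise, at `z`. -/
def drift (ε : ℝ) (f : Torus → ℝ) (z : Plane) : ℝ :=
  1 / 2 * (Δ (lift f)) z + 1 / 2 * |Real.log ε| ^ (-(1 / 2) : ℝ) * ‖∇ (lift f) z‖ ^ 2

/-- `h` is a (strong) solution of
`∂ₜ h = ½ Δh + ½ |log ε|^{-1/2} |∇h|² + √θ Ẇ^ε`, `h(0, ·) = 0`, on `[0, ∞) × 𝕋²`. The noise is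
additive and smooth in space, so the equation, integrated in time, holds pointwise. -/
structure IsSolution (ρ : Mollifier) (W : ℝ≥0 → Lp ℝ 2 (volume : Measure Torus) → Ω → ℝ)
    (P : Measure Ω) (ε θ : ℝ) (h : ℝ≥0 → Torus → Ω → ℝ) : Prop where
  aemeasurable : ∀ t x, AEMeasurable (h t x) P
  contDiff : ∀ᵐ ω ∂P, ∀ t, ContDiff ℝ 2 (lift fun x => h t x ω)
  continuous_derivatives : ∀ᵐ ω ∂P, ∀ k : ℕ, k ≤ 2 → Continuous fun p : ℝ≥0 × Plane =>
    iteratedFDeriv ℝ k (lift fun x => h p.1 x ω) p.2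
  equation : ∀ (t : ℝ≥0) (z : Plane), ∀ᵐ ω ∂P,
    h t (toTorus z) ω =
      (∫ s in (0 : ℝ)..t, drift ε (fun x => h s.toNNReal x ω) z)
        + √θ * mollifiedNoise ρ W ε t (toTorus z) ω

end KPZ

end

/-
By the Hopf-Cole transform, `exp (|log ε|^(-1/2) h)` solves a stochastic heat equation. Its value at
`(t, x)` is the almost sure limit, along refining lattices, of the average over random-walk paths
started at `x` of the exponential of the noise collected along the path. All paths on a lattice
collect noise of the same variance; subtracting half of it produces the leading term and leaves a
partition function of mean one, so it remains to bound the expectation of its logarithm, uniformly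
in the lattice and in `ε`.

Jensen's inequality gives the upper bound. For the lower bound, Gaussian interpolation writes the
expected logarithm as minus an integral of the mean overlap of two replicas sampled from the same
noise. By convexity of the free energy of a two-replica system with an extra attraction, this
overlap is controlled by the exponential moment of the total overlap of two independent walks,
which Khasminskii's lemma bounds: the Green function of the difference walk grows like `|log ε|`
and the squared coupling `θ / |log ε|` compensates it when `θ` is small. Fatou's lemma carries both
bounds to the limit; dividing a bounded quantity by `|log ε|^(-1/2)` gives the error term. The law
of the noise is invariant under translation, whence the independence of `x`.
-/

noncomputable section

namespace KPZ

open Filter Real Topology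
open scoped BigOperators

section GaussianLaw

theorem integrable_gaussianPDFReal_mul {v : ℝ≥0} (hv : v ≠ 0) {g : ℝ → ℝ}
    (hg : Integrable g (gaussianReal 0 v)) :
    Integrable fun x => gaussianPDFReal 0 v x * g x := by
  rw [gaussianReal_of_var_ne_zero _ hv, integrable_withDensity_iff_integrable_smul'
    (measurable_gaussianPDF _ _) (.of_forall fun _ => gaussianPDF_lt_top)] at hg
  simpa only [toReal_gaussianPDF, smul_eq_mul] using hg

theorem hasDerivAt_neg_var_mul_gaussianPDFReal {v : ℝ≥0} (hv : v ≠ 0) (x : ℝ) :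
    HasDerivAt (fun x => -(v : ℝ) * gaussianPDFReal 0 v x) (x * gaussianPDFReal 0 v x) x := by
  have hv' : (v : ℝ) ≠ 0 := by exact_mod_cast hv
  have hexponent : HasDerivAt (fun x : ℝ => -(x - 0) ^ 2 / (2 * (v : ℝ))) (-x / v) x := by
    refine ((((hasDerivAt_id x).sub_const 0).pow 2).neg.div_const (2 * (v : ℝ))).congr_deriv ?_
    simp only [Nat.cast_ofNat, id_eq, sub_zero, Nat.add_one_sub_one, pow_one, mul_one]
    field_simp
  refine ((hexponent.exp.const_mul (√(2 * π * v))⁻¹).const_mul (-(v : ℝ))).congr_deriv ?_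
  rw [gaussianPDFReal]
  field_simp

theorem integral_id_mul_gaussianReal (v : ℝ≥0) {f f' : ℝ → ℝ} (hf : ∀ x, HasDerivAt f (f' x) x)
    (hf'c : Continuous f') {C C' : ℝ} (hC : ∀ x, |f x| ≤ C) (hC' : ∀ x, |f' x| ≤ C') :
    ∫ x, x * f x ∂(gaussianReal 0 v) = v * ∫ x, f' x ∂(gaussianReal 0 v) := by
  rcases eq_or_ne v 0 with rfl | hv
  · simp [gaussianReal_zero_var]
  have hfc : Continuous f := continuous_iff_continuousAt.2 fun x => (hf x).continuousAt
  have hid : Integrable (fun x : ℝ => x) (gaussianReal 0 v) :=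
    memLp_one_iff_integrable.1 (memLp_id_gaussianReal 1)
  have hf_int : Integrable f (gaussianReal 0 v) :=
    .of_bound hfc.aestronglyMeasurable C (.of_forall hC)
  have hf'_int : Integrable f' (gaussianReal 0 v) :=
    .of_bound hf'c.aestronglyMeasurable C' (.of_forall hC')
  have hid_mul : Integrable (fun x => x * f x) (gaussianReal 0 v) :=
    hid.mul_bdd hfc.aestronglyMeasurable (.of_forall hC)
  have hparts := integral_mul_deriv_eq_deriv_mul_of_integrable (u := f) (u' := f')
    (v := fun x => -(v : ℝ) * gaussianPDFReal 0 v x) (v' := fun x => x * gaussianPDFReal 0 v x)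
    (fun x _ => hf x) (fun x _ => hasDerivAt_neg_var_mul_gaussianPDFReal hv x)
    ((integrable_gaussianPDFReal_mul hv hid_mul).congr
      (.of_forall fun x => by simp only [Pi.mul_apply]; ring))
    (((integrable_gaussianPDFReal_mul hv hf'_int).const_mul (-(v : ℝ))).congr
      (.of_forall fun x => by simp only [Pi.mul_apply]; ring))
    (((integrable_gaussianPDFReal_mul hv hf_int).const_mul (-(v : ℝ))).congr
      (.of_forall fun x => by simp only [Pi.mul_apply]; ring))
  rw [integral_gaussianReal_eq_integral_smul hv, integral_gaussianReal_eq_integral_smul hv,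
    ← integral_const_mul]
  simp only [smul_eq_mul]
  rw [← integral_neg] at hparts
  calc ∫ x, gaussianPDFReal 0 v x * (x * f x)
      = ∫ x, f x * (x * gaussianPDFReal 0 v x) := by congr 1; ext x; ring
    _ = ∫ x, -(f' x * (-(v : ℝ) * gaussianPDFReal 0 v x)) := hparts
    _ = ∫ x, (v : ℝ) * (gaussianPDFReal 0 v x * f' x) := by congr 1; ext x; ring

variable {Ω : Type*} [MeasurableSpace Ω] {P : Measure Ω} {J : Type*} {X : J → Ω → ℝ}

theorem covariance_eq_integral_mul (hX : HasGaussianLaw (fun ω j => X j ω) P)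
    (h0 : ∀ j, ∫ ω, X j ω ∂P = 0) (i j : J) : cov[X i, X j; P] = ∫ ω, X i ω * X j ω ∂P := by
  have := hX.isProbabilityMeasure
  rw [covariance_eq_sub (hX.eval i).memLp_two (hX.eval j).memLp_two, h0, h0, mul_zero, sub_zero]
  rfl

theorem map_eq_gaussianReal_integral_sq (hX : HasGaussianLaw (fun ω j => X j ω) P)
    (h0 : ∀ j, ∫ ω, X j ω ∂P = 0) (i : J) :
    P.map (X i) = gaussianReal 0 (∫ ω, X i ω * X i ω ∂P).toNNReal := by
  rw [(hX.eval i).map_eq_gaussianReal, h0, ← covariance_self (hX.eval i).aemeasurable,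
    covariance_eq_integral_mul hX h0]

theorem ae_eq_zero_of_integral_mul_self_eq_zero (hX : HasGaussianLaw (fun ω j => X j ω) P) {i : J}
    (hi : ∫ ω, X i ω * X i ω ∂P = 0) : X i =ᵐ[P] 0 := by
  rw [integral_eq_zero_iff_of_nonneg (fun ω => mul_self_nonneg _)
    ((hX.eval i).memLp_two.integrable_mul (hX.eval i).memLp_two)] at hi
  filter_upwards [hi] with ω hω using mul_self_eq_zero.1 hω

variable (X P) in
/-- The part of a centred Gaussian vector `X` which is independent of its coordinate `X i`: the
residual of the linear regression of `X` on `X i`. -/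
def residual (i : J) (ω : Ω) (j : J) : ℝ :=
  X j ω - (∫ ω, X i ω * X j ω ∂P) / (∫ ω, X i ω * X i ω ∂P) * X i ω

variable [Finite J]

theorem hasGaussianLaw_residual (hX : HasGaussianLaw (fun ω j => X j ω) P) (i : J) :
    HasGaussianLaw (fun ω => (fun _ : Unit => X i ω, residual P X i ω)) P := by
  have := Fintype.ofFinite J
  exact hX.map_fun (ContinuousLinearMap.prod
    (ContinuousLinearMap.pi fun _ : Unit => ContinuousLinearMap.proj i)
    (ContinuousLinearMap.pi fun j => ContinuousLinearMap.proj j -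
      ((∫ ω, X i ω * X j ω ∂P) / (∫ ω, X i ω * X i ω ∂P)) •
        ContinuousLinearMap.proj (R := ℝ) (φ := fun _ : J => ℝ) i))

theorem indepFun_residual (hX : HasGaussianLaw (fun ω j => X j ω) P)
    (h0 : ∀ j, ∫ ω, X j ω ∂P = 0) {i : J} (hi : ∫ ω, X i ω * X i ω ∂P ≠ 0) :
    IndepFun (X i) (residual P X i) P := by
  have := hX.isProbabilityMeasure
  have hunit : IndepFun (fun ω (_ : Unit) => X i ω) (residual P X i) P := by
    refine HasGaussianLaw.indepFun_of_covariance_eval (X := fun (_ : Unit) => X i)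
      (Y := fun j ω => residual P X i ω j) (hasGaussianLaw_residual hX i) fun _ j => ?_
    simp only [residual]
    rw [covariance_fun_sub_right (hX.eval i).memLp_two (hX.eval j).memLp_two
      ((hX.eval i).memLp_two.const_mul _), covariance_const_mul_right,
      covariance_eq_integral_mul hX h0, covariance_eq_integral_mul hX h0, div_mul_cancel₀ _ hi,
      sub_self]
  exact hunit.comp (φ := fun u : Unit → ℝ => u ()) (ψ := id) (measurable_pi_apply _) measurable_id

theorem integral_comp_eq_integral_residual (hX : HasGaussianLaw (fun ω j => X j ω) P)
    (h0 : ∀ j, ∫ ω, X j ω ∂P = 0) {i : J} (hi : ∫ ω, X i ω * X i ω ∂P ≠ 0)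
    {g : ℝ → (J → ℝ) → ℝ} (hg : Continuous (Function.uncurry g))
    (hint : Integrable (fun ω => g (X i ω) fun j => X j ω) P) :
    ∫ ω, g (X i ω) (fun j => X j ω) ∂P = ∫ y, ∫ x,
      g x (y + (x / ∫ ω, X i ω * X i ω ∂P) • fun j => ∫ ω, X i ω * X j ω ∂P)
        ∂(gaussianReal 0 (∫ ω, X i ω * X i ω ∂P).toNNReal) ∂(P.map (residual P X i)) := by
  have := hX.isProbabilityMeasure
  have hXm : AEMeasurable (X i) P := (hX.eval i).aemeasurable
  have hYm : AEMeasurable (residual P X i) P :=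
    aemeasurable_pi_lambda _ fun j => (hX.eval j).aemeasurable.sub (hXm.const_mul _)
  have := Measure.isProbabilityMeasure_map hYm
  have hprod := (indepFun_iff_map_prod_eq_prod_map_map hXm hYm).1 (indepFun_residual hX h0 hi)
  rw [map_eq_gaussianReal_integral_sq hX h0] at hprod
  have hdecomp : ∀ ω, (fun j => X j ω) = residual P X i ω +
      (X i ω / ∫ ω, X i ω * X i ω ∂P) • fun j => ∫ ω, X i ω * X j ω ∂P := fun ω => by
    ext j
    simp only [residual, Pi.add_apply, Pi.smul_apply, smul_eq_mul]
    ring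
  let G : ℝ × (J → ℝ) → ℝ := fun q =>
    g q.1 (q.2 + (q.1 / ∫ ω, X i ω * X i ω ∂P) • fun j => ∫ ω, X i ω * X j ω ∂P)
  have hgG (ω : Ω) : g (X i ω) (fun j => X j ω) = G (X i ω, residual P X i ω) := by
    rw [hdecomp ω]
  have hG_cont : Continuous G := by fun_prop
  have hG : AEStronglyMeasurable G (P.map fun ω => (X i ω, residual P X i ω)) :=
    hG_cont.aestronglyMeasurable
  simp only [hgG] at hint ⊢
  have hG_int := (integrable_map_measure hG (hXm.prodMk hYm)).2 hint
  rw [← integral_map (hXm.prodMk hYm) hG]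
  rw [hprod] at hG_int ⊢
  exact integral_prod_symm G hG_int

theorem gaussian_integration_by_parts (hX : HasGaussianLaw (fun ω j => X j ω) P)
    (h0 : ∀ j, ∫ ω, X j ω ∂P = 0) (i : J) {f f' : (J → ℝ) → ℝ} (hfc : Continuous f)
    (hf'c : Continuous f') {C C' : ℝ} (hC : ∀ x, |f x| ≤ C) (hC' : ∀ x, |f' x| ≤ C')
    (hf : ∀ (x : J → ℝ) (s : ℝ), HasDerivAt
      (fun s : ℝ => f (x + s • fun j => ∫ ω, X i ω * X j ω ∂P))
      (f' (x + s • fun j => ∫ ω, X i ω * X j ω ∂P)) s) :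
    ∫ ω, X i ω * f (fun j => X j ω) ∂P = ∫ ω, f' (fun j => X j ω) ∂P := by
  have := hX.isProbabilityMeasure
  rcases eq_or_ne (∫ ω, X i ω * X i ω ∂P) 0 with hi | hi
  · have hXi := ae_eq_zero_of_integral_mul_self_eq_zero hX hi
    have hdir : (fun j => ∫ ω, X i ω * X j ω ∂P) = 0 := funext fun j =>
      integral_eq_zero_of_ae (hXi.mono fun ω hω => by simp [hω])
    have hf'0 : ∀ x, f' x = 0 := fun x => by
      have := hf x 0
      simp only [hdir, smul_zero, add_zero] at this
      exact this.unique (hasDerivAt_const _ _)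
    simp only [hf'0, integral_zero]
    exact integral_eq_zero_of_ae (hXi.mono fun ω hω => by simp [hω])
  have hX_mul : Integrable (fun ω => X i ω * f fun j => X j ω) P :=
    (hX.eval i).integrable.mul_bdd (hfc.aestronglyMeasurable.comp_aemeasurable hX.aemeasurable)
      (.of_forall fun _ => hC _)
  have hf'_int : Integrable (fun ω => f' fun j => X j ω) P :=
    .of_bound (hf'c.aestronglyMeasurable.comp_aemeasurable hX.aemeasurable) C'
      (.of_forall fun _ => hC' _)
  rw [integral_comp_eq_integral_residual hX h0 hi (g := fun x y => x * f y)
      (continuous_fst.mul (hfc.comp continuous_snd)) hX_mul,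
    integral_comp_eq_integral_residual hX h0 hi (g := fun _ y => f' y)
      (hf'c.comp continuous_snd) hf'_int]
  refine integral_congr_ae (.of_forall fun y => ?_)
  set c : J → ℝ := fun j => ∫ ω, X i ω * X j ω ∂P
  have hci : 0 ≤ ∫ ω, X i ω * X i ω ∂P := integral_nonneg fun ω => mul_self_nonneg _
  set v : ℝ := ∫ ω, X i ω * X i ω ∂P
  have hderiv (x : ℝ) : HasDerivAt (fun x => f (y + (x / v) • c))
      (f' (y + (x / v) • c) * (1 / v)) x :=
    HasDerivAt.comp (h₂ := fun s => f (y + s • c)) x (hf y (x / v))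
      ((hasDerivAt_id x).div_const v)
  have hbound (x : ℝ) : |f' (y + (x / v) • c) * (1 / v)| ≤ C' * |1 / v| := by
    rw [abs_mul]
    exact mul_le_mul_of_nonneg_right (hC' _) (abs_nonneg _)
  beta_reduce
  rw [integral_id_mul_gaussianReal v.toNNReal hderiv (by fun_prop) (fun x => hC _) hbound,
    integral_mul_const, Real.coe_toNNReal _ hci]
  field_simp

theorem map_eq_of_covariance_eq {Ω' : Type*} [MeasurableSpace Ω'] {P' : Measure Ω'}
    {Y : J → Ω' → ℝ} (hX : HasGaussianLaw (fun ω j => X j ω) P)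
    (hY : HasGaussianLaw (fun ω j => Y j ω) P') (hmean : ∀ j, ∫ ω, X j ω ∂P = ∫ ω, Y j ω ∂P')
    (hcov : ∀ i j, cov[X i, X j; P] = cov[Y i, Y j; P']) :
    P.map (fun ω j => X j ω) = P'.map fun ω j => Y j ω := by
  classical
  have := Fintype.ofFinite J
  have := hX.isProbabilityMeasure
  have := hY.isProbabilityMeasure
  have := hX.isGaussian_map
  have := hY.isGaussian_map
  refine Measure.ext_of_charFunDual (funext fun L => ?_)
  obtain ⟨a, ha⟩ : ∃ a : J → ℝ, ∀ x, L x = ∑ j, a j * x j := by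
    refine ⟨fun j => L (Pi.single j 1), fun x => ?_⟩
    conv_lhs => rw [pi_eq_sum_univ' x, map_sum]
    exact Finset.sum_congr rfl fun j _ => by rw [map_smul, smul_eq_mul, mul_comm]
  rw [hX.charFunDual_map_eq_fun, hY.charFunDual_map_eq_fun]
  simp only [ha]
  rw [integral_finsetSum _ fun j _ => (hX.eval j).integrable.const_mul _,
    integral_finsetSum _ fun j _ => (hY.eval j).integrable.const_mul _,
    variance_fun_sum fun j => (hX.eval j).memLp_two.const_mul _,
    variance_fun_sum fun j => (hY.eval j).memLp_two.const_mul _]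
  simp only [integral_const_mul, covariance_const_mul_left, covariance_const_mul_right, hmean, hcov]

end GaussianLaw

section Gibbs

variable {J : Type*} [Fintype J]

/-- The free energy of the energies `y`, with the partition function normalised by the number of
states. -/
def logMeanExp (y : J → ℝ) : ℝ := log (𝔼 j, exp (y j))

/-- The weights of the Gibbs measure with energies `y`. -/
def gibbs (y : J → ℝ) (j : J) : ℝ := exp (y j) / ∑ k, exp (y k)

/-- The mean of the observable `c` under the Gibbs measure with energies `y`. -/
def gibbsMean (y c : J → ℝ) : ℝ := ∑ j, gibbs y j * c j

/-- The mean of `K j k` over two independent samples `j`, `k` (replicas) of the Gibbs measure with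
energies `y`. -/
def overlap (K : J → J → ℝ) (y : J → ℝ) : ℝ := gibbsMean y fun j => gibbsMean y (K j)

theorem gibbsMean_const_mul (y c : J → ℝ) (s : ℝ) :
    gibbsMean y (fun j => s * c j) = s * gibbsMean y c := by
  simp only [gibbsMean, Finset.mul_sum]
  exact Finset.sum_congr rfl fun j _ => by ring

variable [Nonempty J]

theorem sum_exp_pos (y : J → ℝ) : 0 < ∑ j, exp (y j) :=
  Finset.sum_pos (fun _ _ => exp_pos _) Finset.univ_nonempty

theorem expect_exp_pos (y : J → ℝ) : 0 < 𝔼 j, exp (y j) :=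
  Finset.expect_pos (fun _ _ => exp_pos _) Finset.univ_nonempty

theorem logMeanExp_eq_sub (y : J → ℝ) :
    logMeanExp y = log (∑ j, exp (y j)) - log (Fintype.card J) := by
  rw [logMeanExp, Fintype.expect_eq_sum_div_card, log_div (sum_exp_pos y).ne'
    (by exact_mod_cast Fintype.card_ne_zero)]

theorem gibbs_nonneg (y : J → ℝ) (j : J) : 0 ≤ gibbs y j :=
  div_nonneg (exp_pos _).le (sum_exp_pos y).le

theorem sum_gibbs (y : J → ℝ) : ∑ j, gibbs y j = 1 := by
  simp only [gibbs, ← Finset.sum_div]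
  exact div_self (sum_exp_pos y).ne'

theorem abs_gibbs_le_one (y : J → ℝ) (j : J) : |gibbs y j| ≤ 1 := by
  rw [abs_of_nonneg (gibbs_nonneg y j), ← sum_gibbs y]
  exact Finset.single_le_sum (fun k _ => gibbs_nonneg y k) (Finset.mem_univ j)

@[fun_prop]
theorem continuous_gibbs (j : J) : Continuous fun y : J → ℝ => gibbs y j := by
  unfold gibbs
  exact Continuous.div (by fun_prop) (by fun_prop) fun y => (sum_exp_pos y).ne'

@[fun_prop]
theorem continuous_gibbsMean (c : J → ℝ) : Continuous fun y : J → ℝ => gibbsMean y c := by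
  unfold gibbsMean
  fun_prop

theorem continuous_overlap (K : J → J → ℝ) : Continuous (overlap K) := by
  unfold overlap
  simp only [gibbsMean]
  fun_prop

theorem continuous_logMeanExp : Continuous (logMeanExp : (J → ℝ) → ℝ) := by
  simp only [funext logMeanExp_eq_sub]
  exact (Continuous.log (by fun_prop) fun y => (sum_exp_pos y).ne').sub continuous_const

theorem gibbsMean_nonneg (y : J → ℝ) {c : J → ℝ} (hc : ∀ j, 0 ≤ c j) : 0 ≤ gibbsMean y c :=
  Finset.sum_nonneg fun j _ => mul_nonneg (gibbs_nonneg y j) (hc j)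

theorem abs_gibbsMean_le (y c : J → ℝ) : |gibbsMean y c| ≤ ∑ j, |c j| := by
  refine (Finset.abs_sum_le_sum_abs _ _).trans (Finset.sum_le_sum fun j _ => ?_)
  rw [abs_mul]
  exact mul_le_of_le_one_left (abs_nonneg _) (abs_gibbs_le_one y j)

theorem abs_overlap_le (K : J → J → ℝ) (y : J → ℝ) : |overlap K y| ≤ ∑ j, ∑ k, |K j k| :=
  (abs_gibbsMean_le _ _).trans (Finset.sum_le_sum fun _ _ => abs_gibbsMean_le _ _)

theorem logMeanExp_add_const (y : J → ℝ) (c : ℝ) :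
    logMeanExp (fun j => y j + c) = logMeanExp y + c := by
  simp only [logMeanExp, exp_add, ← Finset.expect_mul]
  rw [log_mul (expect_exp_pos y).ne' (exp_pos c).ne', log_exp]

@[simp]
theorem logMeanExp_const (c : ℝ) : logMeanExp (fun _ : J => c) = c := by
  rw [logMeanExp, Finset.expect_const Finset.univ_nonempty, log_exp]

theorem logMeanExp_mono {y z : J → ℝ} (h : ∀ j, y j ≤ z j) : logMeanExp y ≤ logMeanExp z :=
  log_le_log (expect_exp_pos y) (Finset.expect_le_expect fun j _ => exp_le_exp.2 (h j))

theorem logMeanExp_add_gibbsMean_le (y c : J → ℝ) :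
    logMeanExp y + gibbsMean y c ≤ logMeanExp fun j => y j + c j := by
  have hjensen : exp (gibbsMean y c) ≤ ∑ j, gibbs y j * exp (c j) := by
    simpa [gibbsMean] using convexOn_exp.map_sum_le (t := Finset.univ) (w := gibbs y) (p := c)
      (fun j _ => gibbs_nonneg y j) (sum_gibbs y) fun _ _ => Set.mem_univ _
  have hsum : ∑ j, exp (y j + c j) = (∑ j, exp (y j)) * ∑ j, gibbs y j * exp (c j) := by
    rw [Finset.mul_sum]
    refine Finset.sum_congr rfl fun j _ => ?_
    rw [gibbs, exp_add, ← mul_assoc, mul_div_cancel₀ _ (sum_exp_pos y).ne']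
  have hpos := (exp_pos _).trans_le hjensen
  rw [logMeanExp_eq_sub, logMeanExp_eq_sub, hsum, log_mul (sum_exp_pos y).ne' hpos.ne']
  linarith [(le_log_iff_exp_le hpos).2 hjensen]

theorem abs_logMeanExp_le (y : J → ℝ) : |logMeanExp y| ≤ ∑ j, |y j| := by
  have hlower := logMeanExp_add_gibbsMean_le (fun _ : J => (0 : ℝ)) y
  have hupper := logMeanExp_add_gibbsMean_le y fun j => -y j
  have hmean := abs_le.1 (abs_gibbsMean_le (fun _ : J => (0 : ℝ)) y)
  have hmean' := abs_le.1 (abs_gibbsMean_le y fun j => -y j)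
  simp only [zero_add, add_neg_cancel, abs_neg, logMeanExp_const] at hlower hupper hmean'
  rw [abs_le]
  constructor <;> linarith

theorem hasDerivAt_logMeanExp {y : ℝ → J → ℝ} {y' : J → ℝ} {s : ℝ}
    (h : ∀ j, HasDerivAt (fun s => y s j) (y' j) s) :
    HasDerivAt (fun s => logMeanExp (y s)) (gibbsMean (y s) y') s := by
  have hsum : HasDerivAt (fun s => ∑ j, exp (y s j)) (∑ j, exp (y s j) * y' j) s :=
    HasDerivAt.fun_sum fun j _ => (h j).exp
  simp only [logMeanExp_eq_sub]
  refine ((hsum.log (sum_exp_pos _).ne').sub_const _).congr_deriv ?_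
  rw [gibbsMean, Finset.sum_div]
  exact Finset.sum_congr rfl fun j _ => by rw [gibbs]; ring

theorem hasDerivAt_gibbs {y : ℝ → J → ℝ} {y' : J → ℝ} {s : ℝ}
    (h : ∀ j, HasDerivAt (fun s => y s j) (y' j) s) (i : J) :
    HasDerivAt (fun s => gibbs (y s) i) (gibbs (y s) i * (y' i - gibbsMean (y s) y')) s := by
  have hgibbs (y : J → ℝ) : gibbs y i = exp (y i - logMeanExp y) / Fintype.card J := by
    rw [exp_sub, logMeanExp, exp_log (expect_exp_pos y), Fintype.expect_eq_sum_div_card, gibbs]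
    field_simp
  simp only [hgibbs]
  refine (((h i).sub (hasDerivAt_logMeanExp h)).exp.div_const _).congr_deriv ?_
  simp only [Pi.sub_apply]
  ring

end Gibbs

section FreeEnergy

variable {Ω : Type*} {J : Type*}

/-- The energies at coupling strength `s` of a random Hamiltonian `X` with covariances `K`, added to
the deterministic energies `a`. The term `s² K j j / 2` makes `exp (s X j - s² K j j / 2)` have
mean one when `X` is centred Gaussian. -/
def hamiltonian (X : J → Ω → ℝ) (K : J → J → ℝ) (a : J → ℝ) (s : ℝ) (ω : Ω) (j : J) : ℝ :=
  s * X j ω - s ^ 2 * K j j / 2 + a j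

variable {X : J → Ω → ℝ} {K : J → J → ℝ} {a : J → ℝ} {s : ℝ}

theorem hasDerivAt_hamiltonian (ω : Ω) (j : J) :
    HasDerivAt (fun s => hamiltonian X K a s ω j) (X j ω - s * K j j) s := by
  have hlinear : HasDerivAt (fun s : ℝ => s * X j ω) (1 * X j ω) s :=
    (hasDerivAt_id s).mul_const _
  have hsquare : HasDerivAt (fun s : ℝ => s ^ 2 * K j j / 2) _ s :=
    ((hasDerivAt_pow 2 s).mul_const (K j j)).div_const 2
  refine ((hlinear.sub hsquare).add_const (a j)).congr_deriv ?_
  push_cast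
  ring

variable [MeasurableSpace Ω] {P : Measure Ω}

theorem aestronglyMeasurable_hamiltonian [Countable J] (hX : ∀ j, Integrable (X j) P) :
    AEStronglyMeasurable (hamiltonian X K a s) P :=
  (aemeasurable_pi_lambda _ fun j => (((hX j).aemeasurable.const_mul s).sub_const _).add_const _
    ).aestronglyMeasurable

theorem integrable_comp_hamiltonian [Countable J] [IsFiniteMeasure P]
    (hX : ∀ j, Integrable (X j) P) {Φ : (J → ℝ) → ℝ} (hΦ : Continuous Φ) {C : ℝ}
    (hC : ∀ y, |Φ y| ≤ C) :
    Integrable (fun ω => Φ (hamiltonian X K a s ω)) P :=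
  .of_bound (hΦ.comp_aestronglyMeasurable (aestronglyMeasurable_hamiltonian hX)) C
    (.of_forall fun _ => hC _)

variable [Fintype J] [Nonempty J]

theorem integrable_logMeanExp [IsFiniteMeasure P] {Y : J → Ω → ℝ} (hY : ∀ j, Integrable (Y j) P) :
    Integrable (fun ω => logMeanExp fun j => Y j ω) P := by
  have hbound : Integrable (fun ω => ∑ j, |Y j ω|) P :=
    integrable_finsetSum _ fun j _ => (hY j).abs
  exact hbound.mono' (continuous_logMeanExp.comp_aestronglyMeasurable
    (aemeasurable_pi_lambda _ fun j => (hY j).aemeasurable).aestronglyMeasurable)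
    (.of_forall fun ω => abs_logMeanExp_le _)

theorem integrable_logMeanExp_hamiltonian [IsFiniteMeasure P] (hX : ∀ j, Integrable (X j) P) :
    Integrable (fun ω => logMeanExp (hamiltonian X K a s ω)) P :=
  integrable_logMeanExp fun j =>
    (((hX j).const_mul s).sub (integrable_const _)).add (integrable_const _)

theorem integral_mul_gibbs_hamiltonian (hX : HasGaussianLaw (fun ω j => X j ω) P)
    (h0 : ∀ j, ∫ ω, X j ω ∂P = 0) (hK : ∀ j k, ∫ ω, X j ω * X k ω ∂P = K j k) (i : J) :
    ∫ ω, X i ω * gibbs (hamiltonian X K a s ω) i ∂P =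
      s * ∫ ω, gibbs (hamiltonian X K a s ω) i *
        (K i i - gibbsMean (hamiltonian X K a s ω) (K i)) ∂P := by
  let y (x : J → ℝ) (j : J) : ℝ := s * x j - s ^ 2 * K j j / 2 + a j
  have hy : Continuous y := by fun_prop
  have hy' (x : J → ℝ) (r : ℝ) (j : J) :
      HasDerivAt (fun r : ℝ => y (x + r • K i) j) (s * K i j) r := by
    have hline : HasDerivAt (fun r : ℝ => x j + r * K i j) (1 * K i j) r :=
      ((hasDerivAt_id r).mul_const (K i j)).const_add (x j)
    simpa [y] using ((hline.const_mul s).sub_const (s ^ 2 * K j j / 2)).add_const (a j)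
  rw [← integral_const_mul]
  refine gaussian_integration_by_parts hX h0 i (f := fun x => gibbs (y x) i)
    (f' := fun x => s * (gibbs (y x) i * (K i i - gibbsMean (y x) (K i))))
    (by fun_prop) (by fun_prop) (fun x => abs_gibbs_le_one _ _)
    (C' := |s| * (|K i i| + ∑ k, |K i k|)) (fun x => ?_) fun x r => ?_
  · rw [abs_mul, abs_mul]
    refine mul_le_mul_of_nonneg_left ?_ (abs_nonneg _)
    exact (mul_le_of_le_one_left (abs_nonneg _) (abs_gibbs_le_one _ _)).trans
      ((abs_sub _ _).trans (add_le_add_right (abs_gibbsMean_le _ _) _))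
  · simp only [hK]
    refine (hasDerivAt_gibbs (hy' x r) i).congr_deriv ?_
    rw [gibbsMean_const_mul]
    ring

theorem hasDerivAt_integral_logMeanExp_of_integrable [IsFiniteMeasure P]
    (hX : ∀ j, Integrable (X j) P) :
    HasDerivAt (fun s => ∫ ω, logMeanExp (hamiltonian X K a s ω) ∂P)
      (∫ ω, gibbsMean (hamiltonian X K a s ω) (fun j => X j ω - s * K j j) ∂P) s := by
  refine (hasDerivAt_integral_of_dominated_loc_of_deriv_le (s := Metric.ball s 1)
    (bound := fun ω => ∑ j, (|X j ω| + (|s| + 1) * |K j j|)) (Metric.ball_mem_nhds s one_pos)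
    (.of_forall fun s => continuous_logMeanExp.comp_aestronglyMeasurable
      (aestronglyMeasurable_hamiltonian hX))
    (integrable_logMeanExp_hamiltonian hX) ?_ (.of_forall fun ω r hr => ?_)
    (integrable_finsetSum _ fun j _ => (hX j).abs.add (integrable_const _))
    (.of_forall fun ω r _ => hasDerivAt_logMeanExp (hasDerivAt_hamiltonian ω))).2
  · exact Finset.aestronglyMeasurable_fun_sum _ fun j _ =>
      ((continuous_gibbs j).comp_aestronglyMeasurable (aestronglyMeasurable_hamiltonian hX)).mul
        ((hX j).aestronglyMeasurable.sub aestronglyMeasurable_const)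
  · refine (abs_gibbsMean_le _ _).trans (Finset.sum_le_sum fun j _ => ?_)
    have hr' : |r| ≤ |s| + 1 := by
      linarith [abs_sub_abs_le_abs_sub r s, show |r - s| < 1 from hr]
    refine (abs_sub _ _).trans (add_le_add_right ?_ _)
    rw [abs_mul]
    exact mul_le_mul_of_nonneg_right hr' (abs_nonneg _)

theorem hasDerivAt_integral_logMeanExp (hX : HasGaussianLaw (fun ω j => X j ω) P)
    (h0 : ∀ j, ∫ ω, X j ω ∂P = 0) (hK : ∀ j k, ∫ ω, X j ω * X k ω ∂P = K j k) :
    HasDerivAt (fun s => ∫ ω, logMeanExp (hamiltonian X K a s ω) ∂P)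
      (-(s * ∫ ω, overlap K (hamiltonian X K a s ω) ∂P)) s := by
  have := hX.isProbabilityMeasure
  have hXi (j : J) : Integrable (X j) P := (hX.eval j).integrable
  set y : Ω → J → ℝ := hamiltonian X K a s with hy
  have hX_gibbs (j : J) : Integrable (fun ω => X j ω * gibbs (y ω) j) P :=
    (hXi j).mul_bdd ((continuous_gibbs j).comp_aestronglyMeasurable
      (aestronglyMeasurable_hamiltonian hXi)) (.of_forall fun ω => abs_gibbs_le_one _ _)
  have hgibbs (j : J) : Integrable (fun ω => gibbs (y ω) j) P :=
    integrable_comp_hamiltonian hXi (continuous_gibbs j) fun y => abs_gibbs_le_one y j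
  have hgibbs_mean (j : J) : Integrable (fun ω => gibbs (y ω) j * gibbsMean (y ω) (K j)) P :=
    (hgibbs j).mul_bdd ((continuous_gibbsMean (K j)).comp_aestronglyMeasurable
      (aestronglyMeasurable_hamiltonian hXi)) (.of_forall fun ω => abs_gibbsMean_le _ _)
  refine (hasDerivAt_integral_logMeanExp_of_integrable hXi).congr_deriv ?_
  calc ∫ ω, gibbsMean (y ω) (fun j => X j ω - s * K j j) ∂P
      = ∑ j, (∫ ω, X j ω * gibbs (y ω) j ∂P - s * K j j * ∫ ω, gibbs (y ω) j ∂P) := by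
        have hmean (ω : Ω) : gibbsMean (y ω) (fun j => X j ω - s * K j j) =
            ∑ j, (X j ω * gibbs (y ω) j - s * K j j * gibbs (y ω) j) :=
          Finset.sum_congr rfl fun j _ => by ring
        simp only [hmean]
        refine (integral_finsetSum _ fun j _ => (hX_gibbs j).sub ((hgibbs j).const_mul _)).trans
          (Finset.sum_congr rfl fun j _ => ?_)
        exact (integral_sub (hX_gibbs j) ((hgibbs j).const_mul _)).trans
          (by rw [integral_const_mul])
    _ = ∑ j, -(s * ∫ ω, gibbs (y ω) j * gibbsMean (y ω) (K j) ∂P) := by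
        refine Finset.sum_congr rfl fun j _ => ?_
        rw [hy, integral_mul_gibbs_hamiltonian hX h0 hK, ← hy]
        simp only [mul_sub]
        rw [integral_sub ((hgibbs j).mul_const _) (hgibbs_mean j), integral_mul_const]
        ring
    _ = -(s * ∫ ω, overlap K (y ω) ∂P) := by
        simp only [overlap]
        rw [Finset.sum_neg_distrib, ← Finset.mul_sum]
        simp only [gibbsMean] at hgibbs_mean ⊢
        rw [integral_finsetSum _ fun j _ => hgibbs_mean j]

end FreeEnergy

section Replica

variable {I : Type*}

/-- The covariances of the two-replica field `(i, j) ↦ H i + H j`, where `H` has covariances `C`. -/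
def pairCov (C : I → I → ℝ) (q q' : I × I) : ℝ :=
  (C q.1 q'.1 + C q.1 q'.2) + (C q.2 q'.1 + C q.2 q'.2)

variable {Ω : Type*} [MeasurableSpace Ω] {P : Measure Ω} {H : I → Ω → ℝ} {C : I → I → ℝ}

theorem integral_pair_mul_pair (hH : HasGaussianLaw (fun ω i => H i ω) P)
    (hC : ∀ i j, ∫ ω, H i ω * H j ω ∂P = C i j) (q q' : I × I) :
    ∫ ω, (H q.1 ω + H q.2 ω) * (H q'.1 ω + H q'.2 ω) ∂P = pairCov C q q' := by
  have hint (i j : I) : Integrable (fun ω => H i ω * H j ω) P :=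
    (hH.eval i).memLp_two.integrable_mul (hH.eval j).memLp_two
  have hint_add (i j k l : I) : Integrable (fun ω => H i ω * H j ω + H k ω * H l ω) P :=
    (hint i j).add (hint k l)
  simp only [add_mul, mul_add, pairCov]
  rw [integral_add (hint_add _ _ _ _) (hint_add _ _ _ _), integral_add (hint _ _) (hint _ _),
    integral_add (hint _ _) (hint _ _)]
  simp only [hC]
  ring

variable [Fintype I]

theorem sum_exp_add_pair (y : I → ℝ) :
    ∑ q : I × I, exp (y q.1 + y q.2) = (∑ i, exp (y i)) * ∑ i, exp (y i) := by
  rw [Fintype.sum_prod_type, Finset.sum_mul_sum]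
  simp only [exp_add]

theorem gibbs_pair (y : I → ℝ) (q : I × I) :
    gibbs (fun q : I × I => y q.1 + y q.2) q = gibbs y q.1 * gibbs y q.2 := by
  rw [gibbs, gibbs, gibbs, sum_exp_add_pair, exp_add, mul_div_mul_comm]

theorem gibbsMean_pair (C : I → I → ℝ) (y : I → ℝ) :
    gibbsMean (fun q : I × I => y q.1 + y q.2) (fun q => C q.1 q.2) = overlap C y := by
  simp only [overlap, gibbsMean, gibbs_pair, Fintype.sum_prod_type, Finset.mul_sum, mul_assoc]

variable [Nonempty I]

theorem logMeanExp_pair (y : I → ℝ) :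
    logMeanExp (fun q : I × I => y q.1 + y q.2) = 2 * logMeanExp y := by
  have hmul : 𝔼 q : I × I, exp (y q.1 + y q.2) = (𝔼 i, exp (y i)) * 𝔼 i, exp (y i) := by
    rw [Finset.expect_mul_expect, ← Finset.univ_product_univ, Finset.expect_product]
    simp only [exp_add]
  rw [logMeanExp, logMeanExp, hmul, log_mul (expect_exp_pos y).ne' (expect_exp_pos y).ne', two_mul]

theorem antitoneOn_integral_logMeanExp (hH : HasGaussianLaw (fun ω i => H i ω) P)
    (h0 : ∀ i, ∫ ω, H i ω ∂P = 0) (hC : ∀ i j, ∫ ω, H i ω * H j ω ∂P = C i j)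
    (hC0 : ∀ i j, 0 ≤ C i j) (a : I → ℝ) :
    AntitoneOn (fun s => ∫ ω, logMeanExp (hamiltonian H C a s ω) ∂P) (Set.Ici 0) := by
  have hderiv (s : ℝ) := hasDerivAt_integral_logMeanExp (a := a) (s := s) hH h0 hC
  refine antitoneOn_of_deriv_nonpos (convex_Ici 0)
    (fun s _ => (hderiv s).continuousAt.continuousWithinAt)
    (fun s _ => (hderiv s).differentiableAt.differentiableWithinAt) fun s hs => ?_
  rw [interior_Ici] at hs
  rw [(hderiv s).deriv, neg_nonpos]
  exact mul_nonneg (le_of_lt hs) (integral_nonneg fun ω =>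
    gibbsMean_nonneg _ fun i => gibbsMean_nonneg _ (hC0 i))

/-- The logarithm of the exponential moment of the replica overlap under the uniform measure. -/
def logOverlapMoment (C : I → I → ℝ) : ℝ :=
  log (𝔼 i, 𝔼 j, exp (2 * C i j))

-- The pair field with the overlap as an additional attractive energy `2 C` has a free energy which
-- is antitone in `s`, equals `logOverlapMoment C` at `s = 0`, and for `s ≤ 1` dominates the free
-- energy of two independent replicas tilted by `C`.
theorem two_mul_integral_logMeanExp_add_overlap_le (hH : HasGaussianLaw (fun ω i => H i ω) P)
    (h0 : ∀ i, ∫ ω, H i ω ∂P = 0) (hC : ∀ i j, ∫ ω, H i ω * H j ω ∂P = C i j)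
    (hC0 : ∀ i j, 0 ≤ C i j) {s : ℝ} (hs : s ∈ Set.Icc (0 : ℝ) 1) :
    2 * ∫ ω, logMeanExp (hamiltonian H C 0 s ω) ∂P +
      ∫ ω, overlap C (hamiltonian H C 0 s ω) ∂P ≤
    logOverlapMoment C := by
  have := hH.isProbabilityMeasure
  have hHi (i : I) : Integrable (H i) P := (hH.eval i).integrable
  set y : Ω → I → ℝ := hamiltonian H C 0 s
  let X (q : I × I) (ω : Ω) : ℝ := H q.1 ω + H q.2 ω
  let a (q : I × I) : ℝ := 2 * C q.1 q.2
  have hX : HasGaussianLaw (fun ω q => X q ω) P :=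
    hH.map_fun (ContinuousLinearMap.pi fun q : I × I =>
      ContinuousLinearMap.proj (R := ℝ) (φ := fun _ : I => ℝ) q.1 + ContinuousLinearMap.proj q.2)
  have hX0 (q : I × I) : ∫ ω, X q ω ∂P = 0 := by
    simp only [X]
    rw [integral_add (hHi _) (hHi _), h0, h0, add_zero]
  have hXi (q : I × I) : Integrable (X q) P := (hX.eval q).integrable
  have hstart (ω : Ω) : logMeanExp (hamiltonian X (pairCov C) a 0 ω) = logOverlapMoment C := by
    rw [logOverlapMoment, ← Finset.expect_product' Finset.univ Finset.univ
      (fun i j => exp (2 * C i j)), Finset.univ_product_univ, logMeanExp]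
    simp [hamiltonian, a]
  have htilt (ω : Ω) : 2 * logMeanExp (y ω) + overlap C (y ω) ≤
      logMeanExp (hamiltonian X (pairCov C) a s ω) := by
    rw [← logMeanExp_pair, ← gibbsMean_pair]
    refine (logMeanExp_add_gibbsMean_le _ _).trans (logMeanExp_mono fun q => ?_)
    have hsymm : C q.2 q.1 = C q.1 q.2 := by simp only [← hC, mul_comm]
    have hgap : 0 ≤ (1 - s ^ 2) * C q.1 q.2 :=
      mul_nonneg (sub_nonneg.2 (pow_le_one₀ hs.1 hs.2)) (hC0 _ _)
    simp only [y, hamiltonian, X, a, pairCov, hsymm, Pi.zero_apply]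
    linarith
  have hoverlap : Integrable (fun ω => overlap C (y ω)) P :=
    integrable_comp_hamiltonian hHi (continuous_overlap C) (abs_overlap_le C)
  have hlse : Integrable (fun ω => logMeanExp (y ω)) P := integrable_logMeanExp_hamiltonian hHi
  calc 2 * ∫ ω, logMeanExp (y ω) ∂P + ∫ ω, overlap C (y ω) ∂P
      = ∫ ω, (2 * logMeanExp (y ω) + overlap C (y ω)) ∂P := by
        rw [integral_add (hlse.const_mul 2) hoverlap, integral_const_mul]
    _ ≤ ∫ ω, logMeanExp (hamiltonian X (pairCov C) a s ω) ∂P :=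
        integral_mono ((hlse.const_mul 2).add hoverlap)
          (integrable_logMeanExp_hamiltonian hXi) htilt
    _ ≤ ∫ ω, logMeanExp (hamiltonian X (pairCov C) a 0 ω) ∂P :=
        antitoneOn_integral_logMeanExp hX hX0 (integral_pair_mul_pair hH hC)
          (fun q q' => add_nonneg (add_nonneg (hC0 _ _) (hC0 _ _))
            (add_nonneg (hC0 _ _) (hC0 _ _))) a Set.self_mem_Ici hs.1 hs.1
    _ = logOverlapMoment C := by simp only [hstart, integral_const, probReal_univ, one_smul]

theorem one_sub_exp_one_mul_le_of_hasDerivAt {A D : ℝ → ℝ} {c : ℝ} (hA0 : A 0 = 0)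
    (hA : ∀ s, HasDerivAt A (-(s * D s)) s) (hD : ∀ s ∈ Set.Icc (0 : ℝ) 1, 2 * A s + D s ≤ 2 * c) :
    (1 - exp 1) * c ≤ A 1 := by
  have hderiv (s : ℝ) : HasDerivAt (fun s => exp (-s ^ 2) * (A s - c))
      (exp (-s ^ 2) * (s * (2 * c - (2 * A s + D s)))) s := by
    have hexp : HasDerivAt (fun s : ℝ => exp (-s ^ 2)) _ s := ((hasDerivAt_pow 2 s).neg).exp
    refine (hexp.mul ((hA s).sub_const c)).congr_deriv ?_
    push_cast
    simp only [pow_one, Pi.neg_apply]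
    ring
  have hmono : MonotoneOn (fun s => exp (-s ^ 2) * (A s - c)) (Set.Icc 0 1) := by
    refine monotoneOn_of_deriv_nonneg (convex_Icc 0 1)
      (fun s _ => (hderiv s).continuousAt.continuousWithinAt)
      (fun s _ => (hderiv s).differentiableAt.differentiableWithinAt) fun s hs => ?_
    rw [interior_Icc] at hs
    rw [(hderiv s).deriv]
    exact mul_nonneg (exp_pos _).le
      (mul_nonneg hs.1.le (sub_nonneg.2 (hD s ⟨hs.1.le, hs.2.le⟩)))
  have hends := hmono (Set.left_mem_Icc.2 zero_le_one) (Set.right_mem_Icc.2 zero_le_one) zero_le_one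
  norm_num [hA0] at hends
  have hscaled := mul_le_mul_of_nonneg_left hends (exp_pos 1).le
  rw [← mul_assoc, ← exp_add, add_neg_cancel, exp_zero, one_mul] at hscaled
  linarith

theorem neg_logOverlapMoment_le_integral_logMeanExp (hH : HasGaussianLaw (fun ω i => H i ω) P)
    (h0 : ∀ i, ∫ ω, H i ω ∂P = 0) (hC : ∀ i j, ∫ ω, H i ω * H j ω ∂P = C i j)
    (hC0 : ∀ i j, 0 ≤ C i j) :
    -((exp 1 - 1) / 2) * logOverlapMoment C ≤
      ∫ ω, logMeanExp (hamiltonian H C 0 1 ω) ∂P := by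
  have hstart : ∫ ω, logMeanExp (hamiltonian H C 0 0 ω) ∂P = 0 := by
    have hy0 (ω : Ω) : hamiltonian H C 0 0 ω = fun _ => 0 := by ext i; simp [hamiltonian]
    simp only [hy0, logMeanExp_const, integral_zero]
  refine le_trans (le_of_eq ?_) (one_sub_exp_one_mul_le_of_hasDerivAt (c := logOverlapMoment C / 2)
    hstart (fun s => hasDerivAt_integral_logMeanExp hH h0 hC) fun s hs => ?_)
  · ring
  · linarith [two_mul_integral_logMeanExp_add_overlap_le hH h0 hC hC0 hs]

theorem neg_half_le_integral_logMeanExp [IsProbabilityMeasure P] (hH : ∀ i, Integrable (H i) P)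
    (h0 : ∀ i, ∫ ω, H i ω ∂P = 0) {N : ℝ} (hN : ∀ i, C i i ≤ N) :
    -(N / 2) ≤ ∫ ω, logMeanExp (hamiltonian H C 0 1 ω) ∂P := by
  have hmean_int : Integrable (fun ω => gibbsMean 0 fun i => H i ω) P :=
    integrable_finsetSum _ fun i _ => (hH i).const_mul _
  have hmean : ∫ ω, gibbsMean 0 (fun i => H i ω) ∂P = 0 := by
    simp only [gibbsMean]
    rw [integral_finsetSum _ fun i _ => (hH i).const_mul _]
    simp only [integral_const_mul, h0, mul_zero, Finset.sum_const_zero]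
  have hjensen (ω : Ω) : gibbsMean 0 (fun i => H i ω) + -(N / 2) ≤
      logMeanExp (hamiltonian H C 0 1 ω) := by
    have hlse := logMeanExp_add_gibbsMean_le (fun _ => 0) fun i => H i ω
    rw [logMeanExp_const, zero_add] at hlse
    refine (add_le_add_left hlse _).trans ?_
    rw [← logMeanExp_add_const]
    refine logMeanExp_mono fun i => ?_
    simp only [hamiltonian, Pi.zero_apply]
    linarith [hN i]
  calc -(N / 2) = ∫ ω, (gibbsMean 0 (fun i => H i ω) + -(N / 2)) ∂P := by
        rw [integral_add hmean_int (integrable_const _), hmean, integral_const, probReal_univ,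
          one_smul, zero_add]
    _ ≤ ∫ ω, logMeanExp (hamiltonian H C 0 1 ω) ∂P :=
        integral_mono (hmean_int.add (integrable_const _))
          (integrable_logMeanExp_hamiltonian hH) hjensen

end Replica

section Walk

variable {G : Type*} [AddCommGroup G] {E : Type*}

/-- The potential `f` collected along the walk from `z` with increments `σ (p i)`, where time runs
backwards from `n`. -/
def pathEnergy (f : ℕ → G → ℝ) (σ : E → G) : (n : ℕ) → (Fin n → E) → G → ℝ
  | 0, _, _ => 0
  | n + 1, p, z => f n z + pathEnergy f σ n (Fin.tail p) (z + σ (p 0))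

theorem pathEnergy_const_mul (c : ℝ) (f : ℕ → G → ℝ) (σ : E → G) (n : ℕ) (p : Fin n → E) (z : G) :
    pathEnergy (fun k y => c * f k y) σ n p z = c * pathEnergy f σ n p z := by
  induction n generalizing z with
  | zero => simp only [pathEnergy, mul_zero]
  | succ n ih => rw [pathEnergy, pathEnergy, ih, mul_add]

theorem pathEnergy_nonneg {f : ℕ → G → ℝ} (hf : ∀ k z, 0 ≤ f k z) (σ : E → G) (n : ℕ)
    (p : Fin n → E) (z : G) : 0 ≤ pathEnergy f σ n p z := by
  induction n generalizing z with
  | zero => exact le_rfl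
  | succ n ih => exact add_nonneg (hf _ _) (ih _ _)

/-- The steps of the difference of two independent walks with steps `σ`. -/
def differenceStep (σ : E → G) (q : E × E) : G := σ q.1 - σ q.2

theorem pathEnergy_differenceStep_self (V : G → ℝ) (σ : E → G) (n : ℕ) (p : Fin n → E) (z : G) :
    pathEnergy (fun _ => V) (differenceStep σ) n (fun i => (p i, p i)) z = n * V z := by
  induction n with
  | zero => simp [pathEnergy]
  | succ n ih =>
    have htail : pathEnergy (fun _ => V) (differenceStep σ) n (Fin.tail fun i => (p i, p i)) z =
      n * V z := ih (Fin.tail p)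
    rw [pathEnergy, differenceStep, sub_self, add_zero, htail]
    push_cast
    ring

variable [Fintype E]

/-- The discrete evolution in the potential `f` of the constant `1`: at each time step, average over
the steps `σ e` of the walk and multiply by the exponential of the potential. -/
def evolution (f : ℕ → G → ℝ) (σ : E → G) : ℕ → G → ℝ
  | 0, _ => 1
  | k + 1, z => exp (f k z) * 𝔼 e, evolution f σ k (z + σ e)

theorem evolution_eq_expect (f : ℕ → G → ℝ) (σ : E → G) (n : ℕ) (z : G) :
    evolution f σ n z = 𝔼 p : Fin n → E, exp (pathEnergy f σ n p z) := by
  induction n generalizing z with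
  | zero => simp [evolution, pathEnergy]
  | succ n ih =>
    rw [evolution, ← Fintype.expect_equiv (Fin.consEquiv fun _ : Fin (n + 1) => E)
      (fun q => exp (f n z) * exp (pathEnergy f σ n q.2 (z + σ q.1))) _
      fun q => by simp [pathEnergy, exp_add, Fin.consEquiv]]
    rw [← Finset.univ_product_univ, Finset.expect_product, Finset.mul_expect]
    simp only [ih, Finset.mul_expect]

theorem log_evolution (f : ℕ → G → ℝ) (σ : E → G) (n : ℕ) (z : G) :
    log (evolution f σ n z) = logMeanExp fun p => pathEnergy f σ n p z := by
  rw [evolution_eq_expect, logMeanExp]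

theorem expect_pair_exp_pathEnergy (V : G → ℝ) (σ : E → G) (n : ℕ) (c : ℝ) (z : G) :
    𝔼 p : Fin n → E, 𝔼 p' : Fin n → E,
        exp (c * pathEnergy (fun _ => V) (differenceStep σ) n (fun i => (p i, p' i)) z) =
      evolution (fun _ y => c * V y) (differenceStep σ) n z := by
  simp only [← pathEnergy_const_mul c]
  rw [evolution_eq_expect, ← Finset.expect_product' Finset.univ Finset.univ
    (fun p p' : Fin n → E => exp (pathEnergy (fun _ y => c * V y) (differenceStep σ) n
      (fun i => (p i, p' i)) z)), Finset.univ_product_univ]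
  exact Fintype.expect_equiv (Equiv.arrowProdEquivProdArrow (Fin n) (fun _ => E) fun _ => E).symm
    _ _ fun _ => rfl

/-- The truncated Green function `∑ j < k, Qʲ V`, where `Q` is the transition operator of the walk
with steps `τ`. -/
def green (V : G → ℝ) (τ : E → G) : ℕ → G → ℝ
  | 0, _ => 0
  | k + 1, y => V y + 𝔼 e, green V τ k (y + τ e)

theorem green_const_mul (c : ℝ) (V : G → ℝ) (τ : E → G) (k : ℕ) (y : G) :
    green (fun y => c * V y) τ k y = c * green V τ k y := by
  induction k generalizing y with
  | zero => simp only [green, mul_zero]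
  | succ k ih => simp only [green, ih, ← Finset.mul_expect, mul_add]

variable [Nonempty E]

theorem evolution_pos (f : ℕ → G → ℝ) (σ : E → G) (n : ℕ) (z : G) : 0 < evolution f σ n z := by
  rw [evolution_eq_expect]
  exact expect_exp_pos _

-- Khasminskii's lemma: a potential with a small Green function has bounded exponential moments.
theorem evolution_le_one_add_green {V : G → ℝ} (hV : ∀ y, 0 ≤ V y) (hV1 : ∀ y, V y ≤ 1)
    (τ : E → G) {n : ℕ} (hgreen : ∀ k < n, ∀ y, 4 * green V τ k y ≤ 1) (y : G) :
    evolution (fun _ => V) τ n y ≤ 1 + 4 * green V τ n y := by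
  induction n generalizing y with
  | zero => simp [evolution, green]
  | succ n ih =>
    have hle := ih fun k hk => hgreen k (hk.trans n.lt_succ_self)
    set q : ℝ := 𝔼 e, green V τ n (y + τ e) with hq
    have hq1 : 4 * q ≤ 1 := by
      rw [hq, Finset.mul_expect]
      exact Finset.expect_le Finset.univ_nonempty fun e _ => hgreen n n.lt_succ_self _
    have hmean : 𝔼 e, evolution (fun _ => V) τ n (y + τ e) ≤ 1 + 4 * q := by
      rw [hq, Finset.mul_expect, ← Finset.expect_const (Finset.univ_nonempty (α := E)) (1 : ℝ),
        ← Finset.expect_add_distrib]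
      exact Finset.expect_le_expect fun e _ => hle _
    have hexp : exp (V y) ≤ 1 + 2 * V y := by
      have habs := abs_exp_sub_one_le (x := V y) (by rw [abs_of_nonneg (hV y)]; exact hV1 y)
      rw [abs_of_nonneg (hV y)] at habs
      linarith [(abs_le.1 habs).2]
    calc evolution (fun _ => V) τ (n + 1) y
        ≤ (1 + 2 * V y) * (1 + 4 * q) :=
          mul_le_mul hexp hmean (Finset.expect_nonneg fun e _ => (evolution_pos _ τ n _).le)
            (by linarith [hV y])
      _ ≤ 1 + 4 * (V y + q) := by nlinarith [mul_le_mul_of_nonneg_left hq1 (hV y)]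

theorem evolution_le_two {V : G → ℝ} (hV : ∀ y, 0 ≤ V y) (hV1 : ∀ y, V y ≤ 1) (τ : E → G) {n : ℕ}
    (hgreen : ∀ k ≤ n, ∀ y, 4 * green V τ k y ≤ 1) (y : G) :
    evolution (fun _ => V) τ n y ≤ 2 := by
  linarith [evolution_le_one_add_green hV hV1 τ (fun k hk => hgreen k hk.le) y, hgreen n le_rfl y]

end Walk

section LatticeWalk

/-- The sign `±1` encoded by a Boolean. -/
def sgn (b : Bool) : ℝ := if b then 1 else -1

/-- The steps `(±r, ±r)` of the random walk in the plane. -/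
def step (r : ℝ) (e : Bool × Bool) : Plane := !₂[r * sgn e.1, r * sgn e.2]

/-- The phase `2π ⟨m, y⟩`. -/
def phase (m : Fin 2 → ℤ) (y : Plane) : ℝ := 2 * π * (m 0 * y 0 + m 1 * y 1)

/-- The characteristic function at frequency `m` of one step of the difference of two independent
walks with steps `step r`. -/
def stepChar (r : ℝ) (m : Fin 2 → ℤ) : ℝ :=
  cos (2 * π * m 0 * r) ^ 2 * cos (2 * π * m 1 * r) ^ 2

theorem stepChar_nonneg (r : ℝ) (m : Fin 2 → ℤ) : 0 ≤ stepChar r m :=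
  mul_nonneg (sq_nonneg _) (sq_nonneg _)

theorem stepChar_le_one (r : ℝ) (m : Fin 2 → ℤ) : stepChar r m ≤ 1 :=
  mul_le_one₀ (cos_sq_le_one _) (sq_nonneg _) (cos_sq_le_one _)

theorem expect_cos_phase_add_differenceStep (r : ℝ) (m : Fin 2 → ℤ) (y : Plane) :
    𝔼 q, cos (phase m (y + differenceStep (step r) q)) = stepChar r m * cos (phase m y) := by
  set α : ℝ := 2 * π * m 0 * r with hα
  set β : ℝ := 2 * π * m 1 * r with hβ
  have hphase (q : (Bool × Bool) × (Bool × Bool)) : phase m (y + differenceStep (step r) q) =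
      phase m y + α * (sgn q.1.1 - sgn q.2.1) + β * (sgn q.1.2 - sgn q.2.2) := by
    simp only [phase, differenceStep, step, PiLp.add_apply, PiLp.sub_apply,
      Matrix.cons_val_zero, Matrix.cons_val_one, hα, hβ]
    ring
  have hsub : (1 : ℝ) - -1 = 2 ∧ (-1 : ℝ) - 1 = -2 := by norm_num
  rw [Fintype.expect_eq_sum_div_card]
  simp only [hphase, Fintype.sum_prod_type, Fintype.sum_bool, sgn, Fintype.card_prod,
    Fintype.card_bool, if_true, Bool.false_eq_true, if_false, sub_self, mul_zero, add_zero,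
    hsub.1, hsub.2, mul_neg]
  rw [stepChar, ← hα, ← hβ, mul_comm α 2, mul_comm β 2]
  simp only [cos_add, sin_add, cos_neg, sin_neg, cos_two_mul]
  push_cast
  ring

/-- Twice the symbol of the resolvent `(1 / t - Δ)⁻¹` on the torus. -/
def resolventSymbol (t : ℝ) (m : Fin 2 → ℤ) : ℝ :=
  2 / (1 / t + 4 * π ^ 2 * ((m 0 : ℝ) ^ 2 + (m 1 : ℝ) ^ 2))

/-- The discrete analogue of `resolventSymbol` for the difference of two walks with steps `step r`,
performing one step in time `r²`. -/
def walkResolventSymbol (t r : ℝ) (m : Fin 2 → ℤ) : ℝ := 2 / (1 / t + (1 - stepChar r m) / r ^ 2)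

theorem resolventSymbol_nonneg {t : ℝ} (ht : 0 ≤ t) (m : Fin 2 → ℤ) : 0 ≤ resolventSymbol t m := by
  unfold resolventSymbol
  positivity

theorem stepChar_gap_nonneg (r : ℝ) (m : Fin 2 → ℤ) : 0 ≤ (1 - stepChar r m) / r ^ 2 :=
  div_nonneg (sub_nonneg.2 (stepChar_le_one r m)) (sq_nonneg r)

theorem walkResolventSymbol_nonneg {t : ℝ} (ht : 0 ≤ t) (r : ℝ) (m : Fin 2 → ℤ) :
    0 ≤ walkResolventSymbol t r m :=
  div_nonneg zero_le_two (add_nonneg (by positivity) (stepChar_gap_nonneg r m))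

theorem walkResolventSymbol_le {t : ℝ} (ht : 0 < t) (r : ℝ) (m : Fin 2 → ℤ) :
    walkResolventSymbol t r m ≤ 2 * t := by
  refine (div_le_div_of_nonneg_left zero_le_two (by positivity)
    (le_add_of_nonneg_right (stepChar_gap_nonneg r m))).trans_eq ?_
  field_simp

theorem tendsto_one_sub_stepChar (m : Fin 2 → ℤ) :
    Tendsto (fun r => (1 - stepChar r m) / r ^ 2) (𝓝[≠] 0)
      (𝓝 (4 * π ^ 2 * ((m 0 : ℝ) ^ 2 + (m 1 : ℝ) ^ 2))) := by
  have hsin (c : ℝ) : Tendsto (fun r => sin (c * r) / r) (𝓝[≠] 0) (𝓝 c) := by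
    have hderiv : HasDerivAt (fun r : ℝ => sin (c * r)) c 0 := by
      simpa using ((hasDerivAt_id (0 : ℝ)).const_mul c).sin
    refine hderiv.tendsto_slope_zero.congr fun r => ?_
    simp [div_eq_inv_mul]
  have hcos : Tendsto (fun r => cos (2 * π * m 0 * r)) (𝓝[≠] 0) (𝓝 1) := by
    have hcont : Continuous fun r : ℝ => cos (2 * π * m 0 * r) := by fun_prop
    simpa using (hcont.tendsto 0).mono_left nhdsWithin_le_nhds
  have hsum := ((hsin (2 * π * m 0)).pow 2).add ((hcos.pow 2).mul ((hsin (2 * π * m 1)).pow 2))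
  convert hsum using 1
  · funext r
    rw [stepChar, div_pow, div_pow, ← mul_div_assoc, ← add_div, sin_sq, sin_sq]
    ring
  · congr 1
    ring

theorem tendsto_sqrt_div_natCast {t : ℝ} (ht : 0 < t) :
    Tendsto (fun n : ℕ => √(t / n)) atTop (𝓝[≠] 0) := by
  refine tendsto_nhdsWithin_iff.2 ⟨?_, ?_⟩
  · simpa using (tendsto_const_div_atTop_nhds_zero_nat t).sqrt
  · filter_upwards [eventually_gt_atTop 0] with n hn
    exact (sqrt_pos.2 (div_pos ht (by exact_mod_cast hn))).ne'

theorem tendsto_walkResolventSymbol {t : ℝ} (ht : 0 < t) (m : Fin 2 → ℤ) :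
    Tendsto (fun n : ℕ => walkResolventSymbol t √(t / n) m) atTop (𝓝 (resolventSymbol t m)) :=
  Tendsto.div tendsto_const_nhds
    (((tendsto_one_sub_stepChar m).comp (tendsto_sqrt_div_natCast ht)).const_add _) (by positivity)

theorem mul_geom_sum_le {δ t φ : ℝ} {n : ℕ} (hδ : 0 < δ) (ht : 0 < t) (hn : δ * n ≤ t)
    (hφ0 : 0 ≤ φ) (hφ1 : φ ≤ 1) :
    δ * ∑ j ∈ Finset.range n, φ ^ j ≤ 2 / (1 / t + (1 - φ) / δ) := by
  set S := ∑ j ∈ Finset.range n, φ ^ j with hS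
  have hSn : S ≤ n := (Finset.sum_le_sum fun j _ => pow_le_one₀ hφ0 hφ1).trans_eq (by simp)
  have hgeom : S * (1 - φ) ≤ 1 := by
    rw [hS, geom_sum_mul_neg]
    linarith [pow_nonneg hφ0 n]
  have hden : 0 < 1 / t + (1 - φ) / δ :=
    add_pos_of_pos_of_nonneg (by positivity) (div_nonneg (by linarith) hδ.le)
  have hcount : δ * S / t ≤ 1 := by
    rw [div_le_one ht]
    exact (mul_le_mul_of_nonneg_left hSn hδ.le).trans hn
  rw [le_div_iff₀ hden]
  calc δ * S * (1 / t + (1 - φ) / δ) = δ * S / t + S * (1 - φ) := by field_simp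
    _ ≤ 2 := by linarith

theorem summable_mul_of_nonneg_of_le {ι : Type*} {A g : ι → ℝ} {c : ℝ} (hA : ∀ m, 0 ≤ A m)
    (hs : Summable A) (hg : ∀ m, 0 ≤ g m) (hgc : ∀ m, g m ≤ c) : Summable fun m => A m * g m :=
  .of_nonneg_of_le (fun m => mul_nonneg (hA m) (hg m))
    (fun m => mul_le_mul_of_nonneg_left (hgc m) (hA m)) (hs.mul_right c)

variable {A : (Fin 2 → ℤ) → ℝ} {V : Plane → ℝ}

theorem hasSum_green (hV : ∀ y, HasSum (fun m => A m * cos (phase m y)) (V y)) (r : ℝ) (k : ℕ)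
    (y : Plane) :
    HasSum (fun m => A m * (∑ j ∈ Finset.range k, stepChar r m ^ j) * cos (phase m y))
      (green V (differenceStep (step r)) k y) := by
  induction k generalizing y with
  | zero => simp [green]
  | succ k ih =>
    rw [green, Fintype.expect_eq_sum_div_card]
    have hmean := (hasSum_sum fun q (_ : q ∈ Finset.univ) =>
      ih (y + differenceStep (step r) q)).div_const
        (Fintype.card ((Bool × Bool) × (Bool × Bool)) : ℝ)
    refine ((hV y).add hmean).congr_fun fun m => ?_
    rw [← Fintype.expect_eq_sum_div_card, ← Finset.mul_expect,
      expect_cos_phase_add_differenceStep, Finset.sum_range_succ']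
    simp only [pow_succ, ← Finset.sum_mul]
    ring

theorem mul_green_le_tsum (hA : ∀ m, 0 ≤ A m) (hs : Summable A)
    (hV : ∀ y, HasSum (fun m => A m * cos (phase m y)) (V y)) {t : ℝ} (ht : 0 < t) {k n : ℕ}
    (hn : 0 < n) (hk : k ≤ n) (y : Plane) :
    t / n * green V (differenceStep (step √(t / n))) k y ≤
      ∑' m, A m * walkResolventSymbol t √(t / n) m := by
  have hn' : (0 : ℝ) < n := by exact_mod_cast hn
  have hδ : 0 < t / n := div_pos ht hn'
  have hsum := summable_mul_of_nonneg_of_le hA hs (walkResolventSymbol_nonneg ht.le √(t / n))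
    (walkResolventSymbol_le ht √(t / n))
  refine hasSum_le (fun m => ?_) ((hasSum_green hV √(t / n) k y).mul_left (t / n)) hsum.hasSum
  set S := ∑ j ∈ Finset.range k, stepChar √(t / n) m ^ j
  have hS : 0 ≤ S := Finset.sum_nonneg fun j _ => pow_nonneg (stepChar_nonneg _ m) j
  have hsteps : t / n * k ≤ t :=
    (mul_le_mul_of_nonneg_left (Nat.cast_le.2 hk) hδ.le).trans_eq (div_mul_cancel₀ t hn'.ne')
  have hgeom : t / n * S ≤ walkResolventSymbol t √(t / n) m := by
    rw [walkResolventSymbol, sq_sqrt hδ.le]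
    exact mul_geom_sum_le hδ ht hsteps (stepChar_nonneg _ m) (stepChar_le_one _ m)
  calc t / n * (A m * S * cos (phase m y)) ≤ t / n * (A m * S) :=
        mul_le_mul_of_nonneg_left
          (mul_le_of_le_one_right (mul_nonneg (hA m) hS) (cos_le_one _)) hδ.le
    _ = A m * (t / n * S) := mul_left_comm _ _ _
    _ ≤ A m * walkResolventSymbol t √(t / n) m := mul_le_mul_of_nonneg_left hgeom (hA m)

theorem tendsto_tsum_walkResolventSymbol (hA : ∀ m, 0 ≤ A m) (hs : Summable A) {t : ℝ}
    (ht : 0 < t) :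
    Tendsto (fun n : ℕ => ∑' m, A m * walkResolventSymbol t √(t / n) m) atTop
      (𝓝 (∑' m, A m * resolventSymbol t m)) := by
  refine tendsto_tsum_of_dominated_convergence (bound := fun m => A m * (2 * t)) (hs.mul_right _)
    (fun m => (tendsto_walkResolventSymbol ht m).const_mul _) (.of_forall fun n m => ?_)
  rw [norm_of_nonneg (mul_nonneg (hA m) (walkResolventSymbol_nonneg ht.le _ m))]
  exact mul_le_mul_of_nonneg_left (walkResolventSymbol_le ht _ m) (hA m)

/-- The frequencies `m` with `|m|_∞ ≤ N`. -/
def freqBox (N : ℕ) : Finset (Fin 2 → ℤ) :=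
  ((Finset.range (N + 1)).biUnion fun k => Finset.box k).map (finTwoArrowEquiv ℤ).symm.toEmbedding

theorem mem_freqBox {N : ℕ} {m : Fin 2 → ℤ} :
    m ∈ freqBox N ↔ max (m 0).natAbs (m 1).natAbs ≤ N := by
  simp [freqBox, Finset.mem_map_equiv, Int.mem_box]

theorem sq_max_natAbs_le (a b : ℤ) :
    ((max a.natAbs b.natAbs : ℕ) : ℝ) ^ 2 ≤ (a : ℝ) ^ 2 + (b : ℝ) ^ 2 := by
  have hcast (c : ℤ) : ((c.natAbs : ℕ) : ℝ) ^ 2 = (c : ℝ) ^ 2 := by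
    rw [Nat.cast_natAbs, Int.cast_abs, sq_abs]
  rcases max_choice a.natAbs b.natAbs with hmax | hmax <;> rw [hmax, hcast]
  · exact le_add_of_nonneg_right (sq_nonneg _)
  · exact le_add_of_nonneg_left (sq_nonneg _)

theorem resolventSymbol_le_of_le {t : ℝ} (ht : 0 ≤ t) {m : Fin 2 → ℤ} {k : ℕ} (hk : 0 < k)
    (hm : k ≤ max (m 0).natAbs (m 1).natAbs) :
    resolventSymbol t m ≤ (2 * π ^ 2 * (k : ℝ) ^ 2)⁻¹ := by
  have hk' : (0 : ℝ) < k := by exact_mod_cast hk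
  have hsq : (k : ℝ) ^ 2 ≤ (m 0 : ℝ) ^ 2 + (m 1 : ℝ) ^ 2 :=
    (pow_le_pow_left₀ hk'.le (Nat.cast_le.2 hm) 2).trans (sq_max_natAbs_le _ _)
  have hden : 4 * π ^ 2 * (k : ℝ) ^ 2 ≤ 1 / t + 4 * π ^ 2 * ((m 0 : ℝ) ^ 2 + (m 1 : ℝ) ^ 2) :=
    le_add_of_nonneg_of_le (by positivity) (mul_le_mul_of_nonneg_left hsq (by positivity))
  refine (div_le_div_of_nonneg_left zero_le_two (by positivity) hden).trans_eq ?_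
  field_simp
  norm_num

theorem sum_box_resolventSymbol_le {t : ℝ} (ht : 0 ≤ t) (k : ℕ) :
    ∑ x ∈ (Finset.box (k + 1) : Finset (ℤ × ℤ)), resolventSymbol t ((finTwoArrowEquiv ℤ).symm x) ≤
      4 / π ^ 2 * ((k : ℝ) + 1)⁻¹ := by
  refine (Finset.sum_le_card_nsmul _ _ _ fun x hx =>
    resolventSymbol_le_of_le ht k.succ_pos (Int.mem_box.1 hx).ge).trans_eq ?_
  rw [Int.card_box k.succ_ne_zero, nsmul_eq_mul]
  push_cast
  field_simp
  norm_num

theorem sum_freqBox_resolventSymbol_le {t : ℝ} (ht : 0 ≤ t) (N : ℕ) :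
    ∑ m ∈ freqBox N, resolventSymbol t m ≤ 2 * t + 4 / π ^ 2 * (1 + log N) := by
  have hdisj : Set.PairwiseDisjoint (Finset.range (N + 1) : Set ℕ)
      fun k => (Finset.box k : Finset (ℤ × ℤ)) := fun k _ l _ hkl =>
    Finset.disjoint_left.2 fun x hx hx' => hkl ((Int.mem_box.1 hx).symm.trans (Int.mem_box.1 hx'))
  have hharmonic : ∑ k ∈ Finset.range N, ((k : ℝ) + 1)⁻¹ ≤ 1 + log N := by
    have hle := harmonic_le_one_add_log N
    rw [harmonic] at hle
    push_cast at hle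
    exact hle
  rw [freqBox, Finset.sum_map, Finset.sum_biUnion hdisj, Finset.sum_range_succ', add_comm]
  refine add_le_add (by simp [resolventSymbol, finTwoArrowEquiv]) ?_
  refine (Finset.sum_le_sum fun k _ => sum_box_resolventSymbol_le ht k).trans ?_
  rw [← Finset.mul_sum]
  exact mul_le_mul_of_nonneg_left hharmonic (by positivity)

theorem tsum_mul_resolventSymbol_le (hA : ∀ m, 0 ≤ A m) (hA1 : ∀ m, A m ≤ 1) {R : ℝ}
    (hs : HasSum A R) {t : ℝ} (ht : 0 ≤ t) {N : ℕ} (hN : 0 < N) :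
    ∑' m, A m * resolventSymbol t m ≤ 2 * t + 4 / π ^ 2 * (1 + log N) + R / N ^ 2 := by
  set low : (Fin 2 → ℤ) → ℝ := fun m => if m ∈ freqBox N then resolventSymbol t m else 0
  have hle (m : Fin 2 → ℤ) : A m * resolventSymbol t m ≤ low m + A m / N ^ 2 := by
    simp only [low]
    split_ifs with hm
    · exact (mul_le_of_le_one_left (resolventSymbol_nonneg ht m) (hA1 m)).trans
        (le_add_of_nonneg_right (div_nonneg (hA m) (by positivity)))
    · rw [mem_freqBox, not_le] at hm
      rw [zero_add, div_eq_mul_inv]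
      refine mul_le_mul_of_nonneg_left ((resolventSymbol_le_of_le ht hN hm.le).trans ?_) (hA m)
      have : (0 : ℝ) < N := by exact_mod_cast hN
      exact inv_anti₀ (by positivity)
        (le_mul_of_one_le_left (sq_nonneg _) (by nlinarith [pi_gt_three]))
  have hlow : HasSum low (∑ m ∈ freqBox N, resolventSymbol t m) := by
    rw [← Finset.sum_congr rfl fun m hm => if_pos hm]
    exact hasSum_sum_of_ne_finset_zero fun m hm => if_neg hm
  have hmajorant := hlow.add (hs.div_const ((N : ℝ) ^ 2))
  have hsummable : Summable fun m => A m * resolventSymbol t m :=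
    .of_nonneg_of_le (fun m => mul_nonneg (hA m) (resolventSymbol_nonneg ht m)) hle
      hmajorant.summable
  exact (hasSum_le hle hsummable.hasSum hmajorant).trans
    (add_le_add_left (sum_freqBox_resolventSymbol_le ht N) _)

theorem eventually_mul_green_le (hA : ∀ m, 0 ≤ A m) (hA1 : ∀ m, A m ≤ 1) {R : ℝ} (hs : HasSum A R)
    (hV : ∀ y, HasSum (fun m => A m * cos (phase m y)) (V y)) {t : ℝ} (ht : 0 < t) {N : ℕ}
    (hN : 0 < N) :
    ∀ᶠ n : ℕ in atTop, ∀ k ≤ n, ∀ y, t / n * green V (differenceStep (step √(t / n))) k y ≤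
      1 + (2 * t + 4 / π ^ 2 * (1 + log N) + R / N ^ 2) := by
  filter_upwards [(tendsto_tsum_walkResolventSymbol hA hs.summable ht).eventually
    (eventually_le_nhds (lt_one_add _)), eventually_gt_atTop 0] with n hn hn0 k hk y
  exact ((mul_green_le_tsum hA hs.summable hV ht hn0 hk y).trans hn).trans
    (add_le_add_right (tsum_mul_resolventSymbol_le hA hA1 hs ht.le hN) _)

end LatticeWalk

section Correlations

/-- The product of the normalised Haar measures on the two circles, which is the measure used in
Mathlib's Fourier analysis on the torus. -/
def torusHaar : Measure Torus := Measure.pi fun _ => AddCircle.haarAddCircle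

theorem volume_torus : (volume : Measure Torus) = torusHaar := by
  rw [volume_pi, torusHaar]
  congr 1
  ext1 i
  rw [AddCircle.volume_eq_smul_haarAddCircle]
  simp

instance : (volume : Measure UnitAddCircle).IsNegInvariant := inferInstance

instance : (volume : Measure Torus).IsNegInvariant := inferInstance

theorem integral_torus (f : Torus → ℝ) (a : ℝ) :
    ∫ y : Torus, f y = ∫ x in {x : Fin 2 → ℝ | ∀ i, x i ∈ Set.Ioc a (a + 1)}, f (fun i => x i) := by
  rw [volume_torus]
  exact UnitAddTorus.integral_preimage f fun _ => a

theorem hasSum_conj_mFourierCoeff_mul {f g : Torus → ℂ} (hf : MemLp f 2 volume)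
    (hg : MemLp g 2 volume) :
    HasSum (fun m => (starRingEnd ℂ) (∫ y, UnitAddTorus.mFourier (-m) y * f y) *
      ∫ y, UnitAddTorus.mFourier (-m) y * g y) (∫ y, (starRingEnd ℂ) (f y) * g y) := by
  rw [volume_torus] at *
  have hsum : HasSum (fun m => (starRingEnd ℂ)
      (∫ y, UnitAddTorus.mFourier (-m) y * hf.toLp f y ∂torusHaar) *
      (∫ y, UnitAddTorus.mFourier (-m) y * hg.toLp g y ∂torusHaar))
      (∫ y, (starRingEnd ℂ) (hf.toLp f y) * hg.toLp g y ∂torusHaar) :=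
    UnitAddTorus.hasSum_prod_mFourierCoeff (hf.toLp f) (hg.toLp g)
  have hcoeff {f : Torus → ℂ} (hf : MemLp f 2 torusHaar) (m : Fin 2 → ℤ) :
      ∫ y, UnitAddTorus.mFourier (-m) y * hf.toLp f y ∂torusHaar =
        ∫ y, UnitAddTorus.mFourier (-m) y * f y ∂torusHaar :=
    integral_congr_ae (by filter_upwards [hf.coeFn_toLp] with y hy; rw [hy])
  have hinner : ∫ y, (starRingEnd ℂ) (hf.toLp f y) * hg.toLp g y ∂torusHaar =
      ∫ y, (starRingEnd ℂ) (f y) * g y ∂torusHaar :=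
    integral_congr_ae (by
      filter_upwards [hf.coeFn_toLp, hg.coeFn_toLp] with y hfy hgy; rw [hfy, hgy])
  simpa only [hcoeff, hinner] using hsum

theorem norm_mFourier_apply (m : Fin 2 → ℤ) (y : Torus) : ‖UnitAddTorus.mFourier m y‖ = 1 := by
  simp only [UnitAddTorus.mFourier, ContinuousMap.coe_mk, norm_prod, fourier_apply,
    Circle.norm_coe, Finset.prod_const_one]

theorem mFourier_sub_apply (m : Fin 2 → ℤ) (x y : Torus) :
    UnitAddTorus.mFourier m (x - y) = UnitAddTorus.mFourier m x * UnitAddTorus.mFourier (-m) y := by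
  simp only [UnitAddTorus.mFourier, ContinuousMap.coe_mk, ← Finset.prod_mul_distrib]
  refine Finset.prod_congr rfl fun i _ => ?_
  rw [fourier_apply, fourier_apply, fourier_apply, ← Circle.coe_mul, ← AddCircle.toCircle_add]
  congr 2
  rw [Pi.sub_apply, Pi.neg_apply, neg_smul, zsmul_sub, sub_eq_add_neg]

theorem mFourier_toTorus (m : Fin 2 → ℤ) (z : Plane) :
    UnitAddTorus.mFourier m (toTorus z) = Complex.exp (phase m z * Complex.I) := by
  simp only [UnitAddTorus.mFourier, ContinuousMap.coe_mk, toTorus, fourier_coe_apply,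
    Fin.prod_univ_two, ← Complex.exp_add, phase]
  congr 1
  push_cast
  ring

theorem cellRep_coe {x : Fin 2 → ℝ} (hx : ∀ i, x i ∈ Set.Ioc (-1 / 2 : ℝ) (-1 / 2 + 1)) :
    cellRep (fun i => (x i : UnitAddCircle)) = WithLp.toLp 2 x := by
  unfold cellRep
  congr 1
  ext i
  exact AddCircle.equivIoc_coe_of_mem (hx i)

theorem integral_comp_cellRep {F : Plane → ℝ}
    (hF : ∀ x, F x ≠ 0 → ∀ i, x i ∈ Set.Ioc (-1 / 2 : ℝ) (-1 / 2 + 1)) :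
    ∫ y : Torus, F (cellRep y) = ∫ x, F x := by
  have hcell : MeasurableSet {x : Fin 2 → ℝ | ∀ i, x i ∈ Set.Ioc (-1 / 2 : ℝ) (-1 / 2 + 1)} :=
    MeasurableSet.univ_pi' fun _ => measurableSet_Ioc
  rw [integral_torus (fun y => F (cellRep y)) (-1 / 2),
    setIntegral_congr_fun hcell (g := fun x => F (WithLp.toLp 2 x))
      fun x hx => by simp only [cellRep_coe hx],
    setIntegral_eq_integral_of_forall_compl_eq_zero fun x hx =>
      by by_contra hFx; exact hx (hF _ hFx)]
  exact (PiLp.volume_preserving_toLp (Fin 2)).integral_comp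
    (MeasurableEquiv.toLp 2 (Fin 2 → ℝ)).measurableEmbedding F

variable (ρ : Mollifier) {ε : ℝ}

theorem Mollifier.mem_cell_of_scaled_ne_zero (hε : ε ∈ Set.Ioo (0 : ℝ) 1) {x : Plane}
    (hx : ρ.scaled ε x ≠ 0) (i : Fin 2) : x i ∈ Set.Ioc (-1 / 2 : ℝ) (-1 / 2 + 1) := by
  have hsupport : ρ.toFun (ε⁻¹ • x) ≠ 0 := right_ne_zero_of_mul hx
  have hmem := ρ.support_subset (subset_tsupport _ hsupport) i
  have hscale : x i = ε * (ε⁻¹ • x) i := by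
    rw [PiLp.smul_apply, smul_eq_mul, mul_inv_cancel_left₀ hε.1.ne']
  rw [hscale]
  constructor <;> nlinarith [hmem.1, hmem.2, hε.1, hε.2]

theorem integral_comp_inv_smul (F : Plane → ℝ) : ∫ x, F (ε⁻¹ • x) = ε ^ 2 * ∫ x, F x := by
  rw [Measure.integral_comp_smul, finrank_euclideanSpace, Fintype.card_fin,
    abs_of_nonneg (by positivity), smul_eq_mul, inv_pow, inv_inv]

theorem Mollifier.integral_onTorus (hε : ε ∈ Set.Ioo (0 : ℝ) 1) : ∫ y, ρ.onTorus ε y = 1 := by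
  unfold Mollifier.onTorus
  rw [integral_comp_cellRep fun x hx => ρ.mem_cell_of_scaled_ne_zero hε hx]
  unfold Mollifier.scaled
  rw [integral_const_mul, integral_comp_inv_smul, ρ.integral_eq_one, mul_one,
    inv_mul_cancel₀ (pow_ne_zero 2 hε.1.ne')]

theorem Mollifier.integral_onTorus_sq (hε : ε ∈ Set.Ioo (0 : ℝ) 1) :
    ∫ y, ρ.onTorus ε y ^ 2 = (∫ x, ρ.toFun x ^ 2) / ε ^ 2 := by
  unfold Mollifier.onTorus
  rw [integral_comp_cellRep (F := fun x => ρ.scaled ε x ^ 2) fun x hx =>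
    ρ.mem_cell_of_scaled_ne_zero hε (ne_zero_pow two_ne_zero hx)]
  simp only [Mollifier.scaled, mul_pow]
  rw [integral_const_mul, integral_comp_inv_smul fun x => ρ.toFun x ^ 2]
  have := hε.1.ne'
  field_simp

theorem Mollifier.onTorus_nonneg (y : Torus) : 0 ≤ ρ.onTorus ε y :=
  mul_nonneg (by positivity) (ρ.nonneg _)

theorem Mollifier.inner_shiftL2 (ε : ℝ) (a b : Torus) :
    inner ℝ (ρ.shiftL2 ε a) (ρ.shiftL2 ε b) = ∫ y, ρ.onTorus ε (a - y) * ρ.onTorus ε (b - y) := by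
  rw [L2.inner_def]
  refine integral_congr_ae ?_
  filter_upwards [(ρ.memLp_shift ε a).coeFn_toLp, (ρ.memLp_shift ε b).coeFn_toLp] with y ha hb
  rw [Mollifier.shiftL2, Mollifier.shiftL2, ha, hb]
  simp [mul_comm]

/-- The Fourier coefficients of the mollifier on the torus, up to the sign of the frequency. -/
def Mollifier.coeff (ε : ℝ) (m : Fin 2 → ℤ) : ℂ :=
  ∫ y, UnitAddTorus.mFourier m y * (ρ.onTorus ε y : ℂ)

theorem Mollifier.norm_coeff_le (hε : ε ∈ Set.Ioo (0 : ℝ) 1) (m : Fin 2 → ℤ) :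
    ‖ρ.coeff ε m‖ ≤ 1 := by
  rw [← ρ.integral_onTorus hε]
  refine (norm_integral_le_integral_norm _).trans_eq (integral_congr_ae (.of_forall fun y => ?_))
  simp only [norm_mul, norm_mFourier_apply, one_mul, Complex.norm_real,
    norm_of_nonneg (ρ.onTorus_nonneg y)]

theorem Mollifier.integral_mFourier_shift (ε : ℝ) (a : Torus) (m : Fin 2 → ℤ) :
    ∫ y, UnitAddTorus.mFourier (-m) y * (ρ.onTorus ε (a - y) : ℂ) =
      UnitAddTorus.mFourier (-m) a * ρ.coeff ε m := by
  rw [← integral_sub_left_eq_self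
    (fun y : Torus => UnitAddTorus.mFourier (-m) y * (ρ.onTorus ε (a - y) : ℂ)) volume a,
    Mollifier.coeff, ← integral_const_mul]
  refine integral_congr_ae (.of_forall fun y => ?_)
  simp only [mFourier_sub_apply, neg_neg, sub_sub_cancel]
  ring

theorem Mollifier.conj_mul_integral_mFourier_shift (ε : ℝ) (z z' : Plane) (m : Fin 2 → ℤ) :
    (starRingEnd ℂ)
        (∫ y, UnitAddTorus.mFourier (-m) y * (ρ.onTorus ε (toTorus z - y) : ℂ)) *
      ∫ y, UnitAddTorus.mFourier (-m) y * (ρ.onTorus ε (toTorus z' - y) : ℂ) =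
    ((‖ρ.coeff ε m‖ ^ 2 : ℝ) : ℂ) * Complex.exp ((phase m (z - z') : ℝ) * Complex.I) := by
  have hphase : Complex.exp ((phase m (z - z') : ℝ) * Complex.I) =
      Complex.exp (phase m z * Complex.I) * Complex.exp (phase m z' * -Complex.I) := by
    rw [← Complex.exp_add]
    congr 1
    simp only [phase, PiLp.sub_apply]
    push_cast
    ring
  rw [ρ.integral_mFourier_shift, ρ.integral_mFourier_shift, map_mul, UnitAddTorus.mFourier_neg,
    UnitAddTorus.mFourier_neg, Complex.conj_conj, mFourier_toTorus, mFourier_toTorus,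
    ← Complex.exp_conj, map_mul, Complex.conj_I, Complex.conj_ofReal, hphase, Complex.ofReal_pow,
    ← Complex.conj_mul']
  ring

theorem Mollifier.hasSum_inner_shiftL2 (ε : ℝ) (z z' : Plane) :
    HasSum (fun m => ‖ρ.coeff ε m‖ ^ 2 * cos (phase m (z - z')))
      (inner ℝ (ρ.shiftL2 ε (toTorus z)) (ρ.shiftL2 ε (toTorus z'))) := by
  have hinner : ∫ y : Torus, (starRingEnd ℂ) (ρ.onTorus ε (toTorus z - y) : ℂ) *
      (ρ.onTorus ε (toTorus z' - y) : ℂ) =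
        ((inner ℝ (ρ.shiftL2 ε (toTorus z)) (ρ.shiftL2 ε (toTorus z')) : ℝ) : ℂ) := by
    rw [ρ.inner_shiftL2, ← integral_complex_ofReal]
    exact integral_congr_ae (.of_forall fun y => by simp)
  have hshift (x : Torus) : MemLp (fun y : Torus => (ρ.onTorus ε (x - y) : ℂ)) 2 volume :=
    (ρ.memLp_shift ε x).ofReal
  have hparseval := Complex.hasSum_re
    (hasSum_conj_mFourierCoeff_mul (hshift (toTorus z)) (hshift (toTorus z')))
  simpa only [hinner, Complex.ofReal_re, ρ.conj_mul_integral_mFourier_shift,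
    Complex.re_ofReal_mul, Complex.exp_ofReal_mul_I_re] using hparseval

/-- The correlation function `ρ^ε * ρ^ε` of the mollified noise. -/
def Mollifier.corr (ε : ℝ) (y : Plane) : ℝ :=
  inner ℝ (ρ.shiftL2 ε (toTorus y)) (ρ.shiftL2 ε (toTorus 0))

theorem Mollifier.hasSum_corr (ε : ℝ) (y : Plane) :
    HasSum (fun m => ‖ρ.coeff ε m‖ ^ 2 * cos (phase m y)) (ρ.corr ε y) := by
  simpa [Mollifier.corr, toTorus] using ρ.hasSum_inner_shiftL2 ε y 0

theorem Mollifier.inner_shiftL2_toTorus (ε : ℝ) (z z' : Plane) :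
    inner ℝ (ρ.shiftL2 ε (toTorus z)) (ρ.shiftL2 ε (toTorus z')) = ρ.corr ε (z - z') :=
  (ρ.hasSum_inner_shiftL2 ε z z').unique (ρ.hasSum_corr ε (z - z'))

theorem Mollifier.corr_nonneg (ε : ℝ) (y : Plane) : 0 ≤ ρ.corr ε y := by
  rw [Mollifier.corr, ρ.inner_shiftL2]
  exact integral_nonneg fun y => mul_nonneg (ρ.onTorus_nonneg _) (ρ.onTorus_nonneg _)

theorem Mollifier.corr_zero (hε : ε ∈ Set.Ioo (0 : ℝ) 1) :
    ρ.corr ε 0 = (∫ x, ρ.toFun x ^ 2) / ε ^ 2 := by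
  rw [Mollifier.corr, ρ.inner_shiftL2, ← ρ.integral_onTorus_sq hε,
    ← integral_sub_left_eq_self (fun y => ρ.onTorus ε y ^ 2) volume (toTorus 0)]
  simp only [sq]

theorem Mollifier.hasSum_norm_coeff_sq (ε : ℝ) :
    HasSum (fun m => ‖ρ.coeff ε m‖ ^ 2) (ρ.corr ε 0) := by
  simpa [phase] using ρ.hasSum_corr ε 0

theorem Mollifier.corr_le (ε : ℝ) (y : Plane) : ρ.corr ε y ≤ ρ.corr ε 0 :=
  hasSum_le (fun _ => mul_le_of_le_one_right (sq_nonneg _) (cos_le_one _))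
    (ρ.hasSum_corr ε y) (ρ.hasSum_norm_coeff_sq ε)

end Correlations

section Noise

variable {Ω : Type*} {W : ℝ≥0 → Lp ℝ 2 (volume : Measure Torus) → Ω → ℝ}

/-- The space of linear functionals of the noise, that is, the linear span of the random variables
`W t f`. -/
def noiseSpan (W : ℝ≥0 → Lp ℝ 2 (volume : Measure Torus) → Ω → ℝ) : Submodule ℝ (Ω → ℝ) :=
  Submodule.span ℝ (Set.range fun q : ℝ≥0 × Lp ℝ 2 (volume : Measure Torus) => W q.1 q.2)

/-- The increment over the `k`-th time step of length `δ` of the mollified noise, times `c`. The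
sample point comes before the step and the position, so that `noiseStep ρ W ε c δ ω` is a
potential for `pathEnergy` and `evolution`. -/
def noiseStep (ρ : Mollifier) (W : ℝ≥0 → Lp ℝ 2 (volume : Measure Torus) → Ω → ℝ) (ε c : ℝ)
    (δ : ℝ≥0) (ω : Ω) (k : ℕ) (z : Plane) : ℝ :=
  c * (mollifiedNoise ρ W ε ((k + 1 : ℕ) * δ) (toTorus z) ω
    - mollifiedNoise ρ W ε (k * δ) (toTorus z) ω)

theorem mem_noiseSpan (t : ℝ≥0) (f : Lp ℝ 2 (volume : Measure Torus)) : W t f ∈ noiseSpan W :=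
  Submodule.subset_span ⟨(t, f), rfl⟩

theorem noiseStep_mem (ρ : Mollifier) (ε c : ℝ) (δ : ℝ≥0) (k : ℕ) (z : Plane) :
    (fun ω => noiseStep ρ W ε c δ ω k z) ∈ noiseSpan W :=
  (noiseSpan W).smul_mem c ((noiseSpan W).sub_mem (mem_noiseSpan _ _) (mem_noiseSpan _ _))

theorem pathEnergy_mem {E : Type*} (ρ : Mollifier) (ε c : ℝ) (δ : ℝ≥0) (σ : E → Plane) (n : ℕ)
    (p : Fin n → E) (z : Plane) :
    (fun ω => pathEnergy (noiseStep ρ W ε c δ ω) σ n p z) ∈ noiseSpan W := by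
  induction n generalizing z with
  | zero => exact (noiseSpan W).zero_mem
  | succ n ih => exact (noiseSpan W).add_mem (noiseStep_mem ρ ε c δ n z) (ih _ _)

variable [MeasurableSpace Ω] {P : Measure Ω}

theorem hasGaussianLaw_of_mem_span {T : Type*} {Y : T → Ω → ℝ} (hY : IsGaussianProcess Y P)
    {J : Type*} [Finite J] {X : J → Ω → ℝ} (hX : ∀ j, X j ∈ Submodule.span ℝ (Set.range Y)) :
    HasGaussianLaw (fun ω j => X j ω) P := by
  have := Fintype.ofFinite J
  have hprocess : IsGaussianProcess X P := by
    refine hY.of_isGaussianProcess fun j => ?_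
    obtain ⟨c, hc⟩ := Finsupp.mem_span_range_iff_exists_finsupp.1 (hX j)
    refine ⟨c.support, ∑ i : c.support, c i • ContinuousLinearMap.proj i, fun ω => ?_⟩
    rw [← hc, Finsupp.sum, Finset.sum_apply, sum_apply, ← Finset.sum_coe_sort c.support]
    simp
  exact (hprocess.hasGaussianLaw Finset.univ).map_fun (ContinuousLinearMap.pi fun j =>
    ContinuousLinearMap.proj (R := ℝ) (φ := fun _ : (Finset.univ : Finset J) => ℝ)
      ⟨j, Finset.mem_univ j⟩)

namespace IsCylindricalWiener

theorem hasGaussianLaw (hW : IsCylindricalWiener W P) {J : Type*} [Finite J] {X : J → Ω → ℝ}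
    (hX : ∀ j, X j ∈ noiseSpan W) : HasGaussianLaw (fun ω j => X j ω) P :=
  hasGaussianLaw_of_mem_span hW.gaussian hX

theorem memLp (hW : IsCylindricalWiener W P) {X : Ω → ℝ} (hX : X ∈ noiseSpan W) : MemLp X 2 P :=
  ((hW.hasGaussianLaw (J := Unit) (X := fun _ => X) fun _ => hX).eval ()).memLp_two

theorem integrable (hW : IsCylindricalWiener W P) {X : Ω → ℝ} (hX : X ∈ noiseSpan W) :
    Integrable X P :=
  ((hW.hasGaussianLaw (J := Unit) (X := fun _ => X) fun _ => hX).eval ()).integrable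

theorem integrable_mul (hW : IsCylindricalWiener W P) {X Y : Ω → ℝ} (hX : X ∈ noiseSpan W)
    (hY : Y ∈ noiseSpan W) : Integrable (fun ω => X ω * Y ω) P :=
  (hW.memLp hX).integrable_mul (hW.memLp hY)

theorem integral_eq_zero (hW : IsCylindricalWiener W P) {X : Ω → ℝ} (hX : X ∈ noiseSpan W) :
    ∫ ω, X ω ∂P = 0 := by
  induction hX using Submodule.span_induction with
  | mem X hX => obtain ⟨q, rfl⟩ := hX; exact hW.centered _ _
  | zero => simp
  | add X Y hX hY ihX ihY =>
    simp only [Pi.add_apply]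
    rw [integral_add (hW.integrable hX) (hW.integrable hY), ihX, ihY, add_zero]
  | smul c X _ ihX => simp only [Pi.smul_apply, smul_eq_mul, integral_const_mul, ihX, mul_zero]

theorem integral_add_mul_add (hW : IsCylindricalWiener W P) {X Y X' Y' : Ω → ℝ}
    (hX : X ∈ noiseSpan W) (hY : Y ∈ noiseSpan W) (hX' : X' ∈ noiseSpan W)
    (hY' : Y' ∈ noiseSpan W) :
    ∫ ω, (X ω + Y ω) * (X' ω + Y' ω) ∂P =
      ∫ ω, X ω * X' ω ∂P + ∫ ω, X ω * Y' ω ∂P + (∫ ω, X' ω * Y ω ∂P + ∫ ω, Y ω * Y' ω ∂P) := by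
  rw [← integral_add (hW.integrable_mul hX hX') (hW.integrable_mul hX hY'),
    ← integral_add (hW.integrable_mul hX' hY) (hW.integrable_mul hY hY'),
    ← integral_add ((hW.integrable_mul hX hX').fun_add (hW.integrable_mul hX hY'))
      ((hW.integrable_mul hX' hY).fun_add (hW.integrable_mul hY hY'))]
  congr 1 with ω
  ring

theorem integral_sub_mul_sub (hW : IsCylindricalWiener W P) (s s' t t' : ℝ≥0)
    (f g : Lp ℝ 2 (volume : Measure Torus)) :
    ∫ ω, (W s' f ω - W s f ω) * (W t' g ω - W t g ω) ∂P =
      (min (s' : ℝ) t' - min (s' : ℝ) t - (min (s : ℝ) t' - min (s : ℝ) t)) * inner ℝ f g := by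
  have hexpand := hW.integral_add_mul_add (mem_noiseSpan s' f)
    ((noiseSpan W).neg_mem (mem_noiseSpan s f)) (mem_noiseSpan t' g)
    ((noiseSpan W).neg_mem (mem_noiseSpan t g))
  simp only [Pi.neg_apply, mul_neg, neg_mul, neg_neg, integral_neg, hW.covariance,
    ← sub_eq_add_neg, min_comm (t' : ℝ), real_inner_comm f g] at hexpand
  rw [hexpand]
  ring

end IsCylindricalWiener

theorem min_steps (δ : ℝ≥0) (k l : ℕ) :
    min ((((k + 1 : ℕ) * δ : ℝ≥0)) : ℝ) ((l + 1 : ℕ) * δ : ℝ≥0) -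
        min (((k + 1 : ℕ) * δ : ℝ≥0) : ℝ) (l * δ : ℝ≥0) -
      (min ((k * δ : ℝ≥0) : ℝ) ((l + 1 : ℕ) * δ : ℝ≥0) - min ((k * δ : ℝ≥0) : ℝ) (l * δ : ℝ≥0)) =
    if k = l then (δ : ℝ) else 0 := by
  have hmin (a b : ℕ) : min ((a * δ : ℝ≥0) : ℝ) (b * δ : ℝ≥0) = (min a b : ℕ) * δ := by
    push_cast
    rw [min_mul_of_nonneg _ _ δ.coe_nonneg]
  simp only [hmin, ← sub_mul]
  rcases lt_trichotomy k l with hkl | rfl | hkl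
  · rw [min_eq_left (by lia), min_eq_left (by lia), min_eq_left (by lia), min_eq_left (by lia),
      if_neg hkl.ne]
    ring
  · rw [if_pos rfl, min_self, min_self, min_eq_right k.le_succ, min_eq_left k.le_succ]
    push_cast
    ring
  · rw [min_eq_right (by lia), min_eq_right (by lia), min_eq_right (by lia),
      min_eq_right (by lia), if_neg hkl.ne']
    ring

namespace IsCylindricalWiener

variable (hW : IsCylindricalWiener W P) (ρ : Mollifier) (ε c : ℝ) (δ : ℝ≥0)
include hW

theorem covariance_noiseStep (k l : ℕ) (z z' : Plane) :
    ∫ ω, noiseStep ρ W ε c δ ω k z * noiseStep ρ W ε c δ ω l z' ∂P =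
      if k = l then c ^ 2 * δ * ρ.corr ε (z - z') else 0 := by
  simp only [noiseStep, mollifiedNoise, mul_mul_mul_comm c]
  rw [integral_const_mul, hW.integral_sub_mul_sub, min_steps, ρ.inner_shiftL2_toTorus]
  split_ifs <;> ring

variable {E : Type*} (σ : E → Plane)

theorem covariance_noiseStep_pathEnergy {k n : ℕ} (hn : n ≤ k) (p : Fin n → E) (z z' : Plane) :
    ∫ ω, noiseStep ρ W ε c δ ω k z * pathEnergy (noiseStep ρ W ε c δ ω) σ n p z' ∂P = 0 := by
  induction n generalizing z' with
  | zero => simp [pathEnergy]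
  | succ n ih =>
    simp only [pathEnergy, mul_add]
    rw [integral_add (hW.integrable_mul (noiseStep_mem ρ ε c δ k z) (noiseStep_mem ρ ε c δ n z'))
      (hW.integrable_mul (noiseStep_mem ρ ε c δ k z) (pathEnergy_mem ρ ε c δ σ n _ _)),
      hW.covariance_noiseStep, if_neg (by lia), ih (by lia), add_zero]

theorem covariance_pathEnergy (n : ℕ) (p p' : Fin n → E) (z z' : Plane) :
    ∫ ω, pathEnergy (noiseStep ρ W ε c δ ω) σ n p z *
        pathEnergy (noiseStep ρ W ε c δ ω) σ n p' z' ∂P =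
      pathEnergy (fun _ y => c ^ 2 * δ * ρ.corr ε y) (differenceStep σ) n
        (fun i => (p i, p' i)) (z - z') := by
  induction n generalizing z z' with
  | zero => simp [pathEnergy]
  | succ n ih =>
    have hdifference : z + σ (p 0) - (z' + σ (p' 0)) = z - z' + differenceStep σ (p 0, p' 0) := by
      simp only [differenceStep]
      abel
    simp only [pathEnergy]
    rw [hW.integral_add_mul_add (noiseStep_mem ρ ε c δ n z) (pathEnergy_mem ρ ε c δ σ n _ _)
      (noiseStep_mem ρ ε c δ n z') (pathEnergy_mem ρ ε c δ σ n _ _),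
      hW.covariance_noiseStep, if_pos rfl, hW.covariance_noiseStep_pathEnergy ρ ε c δ σ le_rfl,
      hW.covariance_noiseStep_pathEnergy ρ ε c δ σ le_rfl, ih, hdifference, add_zero, zero_add]
    rfl

end IsCylindricalWiener

end Noise

section LogExpansion

theorem abs_log_sub_le_two_mul_sq {y : ℝ} (hy : 1 / 2 ≤ y) :
    |log y - (y - 1)| ≤ 2 * (y - 1) ^ 2 := by
  have hpos : 0 < y := by linarith
  have hupper := log_le_sub_one_of_pos hpos
  have hlower := one_sub_inv_le_log_of_pos hpos
  have hinv : 1 - y⁻¹ - ((y - 1) - 2 * (y - 1) ^ 2) = (y - 1) ^ 2 * (2 * y - 1) / y := by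
    field_simp
    ring
  have hremainder : 0 ≤ (y - 1) ^ 2 * (2 * y - 1) / y :=
    div_nonneg (mul_nonneg (sq_nonneg _) (by linarith)) hpos.le
  rw [abs_le]
  constructor <;> nlinarith [sq_nonneg (y - 1)]

theorem eventually_abs_log_sub_le {η : ℝ} (hη : 0 < η) (B : ℝ) :
    ∀ᶠ δ in 𝓝[≥] (0 : ℝ), ∀ y b, |b| ≤ B → |y - (1 + δ * b)| ≤ η * δ →
      |log y - δ * b| ≤ 2 * η * δ := by
  have hhalf : ∀ᶠ δ in 𝓝[≥] (0 : ℝ), δ * (B + η) ≤ 1 / 2 :=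
    eventually_nhdsWithin_of_eventually_nhds <|
      (Continuous.tendsto' (by fun_prop) 0 0 (by simp)).eventually_le_const (by norm_num)
  have hsmall : ∀ᶠ δ in 𝓝[≥] (0 : ℝ), δ * (2 * (B + η) ^ 2) ≤ η :=
    eventually_nhdsWithin_of_eventually_nhds <|
      (Continuous.tendsto' (by fun_prop) 0 0 (by simp)).eventually_le_const hη
  filter_upwards [hhalf, hsmall, self_mem_nhdsWithin] with δ hhalf hsmall hδ y b hb hy
  have hδ : 0 ≤ δ := hδ
  obtain ⟨hylower, hyupper⟩ := abs_le.1 hy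
  obtain ⟨hblower, hbupper⟩ := abs_le.1 hb
  have hsub_le : y - 1 ≤ δ * (B + η) := by nlinarith
  have hle_sub : -(δ * (B + η)) ≤ y - 1 := by nlinarith
  have hsq : 2 * (y - 1) ^ 2 ≤ η * δ := by
    nlinarith [sq_le_sq' hle_sub hsub_le, mul_le_mul_of_nonneg_left hsmall hδ]
  obtain ⟨hloglower, hlogupper⟩ :=
    abs_le.1 (abs_log_sub_le_two_mul_sq (by linarith : 1 / 2 ≤ y))
  rw [abs_le]
  constructor <;> linarith

end LogExpansion

section Taylor

theorem abs_sub_le_mul_of_hasDerivAt {g g' : ℝ → ℝ} {r C : ℝ} (hg : ∀ x, HasDerivAt g (g' x) x)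
    (hg' : ∀ x ∈ Set.Icc 0 r, |g' x| ≤ C) {x : ℝ} (hx : x ∈ Set.Icc 0 r) :
    |g x - g 0| ≤ C * x := by
  simpa using norm_image_sub_le_of_norm_deriv_le_segment' (fun x _ => (hg x).hasDerivWithinAt)
    (fun x hx => hg' x ⟨hx.1, hx.2.le⟩) x hx

theorem abs_sub_taylor_le {f f' f'' : ℝ → ℝ} {r c η : ℝ} (hr : 0 ≤ r)
    (hf : ∀ x, HasDerivAt f (f' x) x) (hf' : ∀ x, HasDerivAt f' (f'' x) x)
    (hη : ∀ x ∈ Set.Icc 0 r, |f'' x - c| ≤ η) :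
    |f r - (f 0 + r * f' 0 + r ^ 2 / 2 * c)| ≤ η * r ^ 2 := by
  have hη0 : 0 ≤ η := (abs_nonneg _).trans (hη 0 ⟨le_rfl, hr⟩)
  have hfirst (x : ℝ) (hx : x ∈ Set.Icc 0 r) : |f' x - f' 0 - c * x| ≤ η * r := by
    have hmean := abs_sub_le_mul_of_hasDerivAt (g := fun x => f' x - c * x)
      (fun x => (hf' x).sub (by simpa using (hasDerivAt_id x).const_mul c)) hη hx
    rw [mul_zero, sub_zero, sub_right_comm] at hmean
    exact hmean.trans (mul_le_mul_of_nonneg_left hx.2 hη0)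
  have hsecond := abs_sub_le_mul_of_hasDerivAt
    (g := fun x => f x - (x * f' 0 + x ^ 2 / 2 * c)) (fun x => by
      refine ((hf x).sub (((hasDerivAt_id x).mul_const (f' 0)).add
        (((hasDerivAt_pow 2 x).div_const 2).mul_const c))).congr_deriv ?_
      push_cast
      ring) hfirst ⟨hr, le_rfl⟩
  convert hsecond using 1
  · congr 1
    ring
  · ring

theorem eventually_abs_sub_le {X : Type*} [TopologicalSpace X] {K : Set X} (hK : IsCompact K)
    {F : ℝ × X → ℝ} (hF : Continuous F) {η : ℝ} (hη : 0 < η) :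
    ∀ᶠ r in 𝓝 0, ∀ x ∈ K, |F (r, x) - F (0, x)| ≤ η :=
  hK.eventually_forall_of_forall_eventually fun x _ =>
    (Continuous.tendsto' (f := fun q : ℝ × X => |F q - F (0, q.2)|) (by fun_prop) (0, x) 0
      (by simp)).eventually_le_const hη

theorem eventually_forall_mem_Icc {p : ℝ → Prop} (hp : ∀ᶠ x in 𝓝 0, p x) :
    ∀ᶠ r in 𝓝 0, ∀ x ∈ Set.Icc 0 r, p x :=
  (tendsto_const_nhds.Icc tendsto_id).eventually hp.smallSets

end Taylor

section Periodicity

theorem toTorus_add (z w : Plane) : toTorus (z + w) = toTorus z + toTorus w := by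
  ext i
  simp [toTorus]

theorem toTorus_cellRep (y : Torus) : toTorus (cellRep y) = y := by
  ext i
  simp only [toTorus, cellRep]
  exact AddCircle.coe_equivIoc

theorem cellRep_mem_closedBall (y : Torus) : cellRep y ∈ Metric.closedBall (0 : Plane) 1 := by
  have hcoord (i : Fin 2) : cellRep y i ^ 2 ≤ 1 / 4 := by
    obtain ⟨hlower, hupper⟩ := (AddCircle.equivIoc (1 : ℝ) (-1 / 2) (y i)).2
    change ((AddCircle.equivIoc (1 : ℝ) (-1 / 2) (y i) : Set.Ioc _ _) : ℝ) ^ 2 ≤ 1 / 4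
    nlinarith
  rw [mem_closedBall_zero_iff, EuclideanSpace.norm_eq, Real.sqrt_le_left (by norm_num), one_pow]
  simp only [Fin.sum_univ_two, norm_eq_abs, sq_abs]
  linarith [hcoord 0, hcoord 1]

theorem lift_add_eq {z z' : Plane} (h : toTorus z = toTorus z') (f : Torus → ℝ) (w : Plane) :
    lift f (z + w) = lift f (z' + w) := by
  simp only [lift, toTorus_add, h]

theorem drift_eq_of_toTorus_eq {z z' : Plane} (h : toTorus z = toTorus z') (ε : ℝ)
    (f : Torus → ℝ) : drift ε f z = drift ε f z' := by
  have hperiod : (fun w => lift f (w + (z - z'))) = lift f := by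
    ext w
    simpa [add_sub_cancel, add_sub_left_comm] using lift_add_eq h f (w - z')
  have hfderiv : fderiv ℝ (lift f) z = fderiv ℝ (lift f) z' := by
    simpa only [hperiod, add_sub_cancel] using
      (fderiv_comp_add_right (𝕜 := ℝ) (f := lift f) (x := z') (z - z')).symm
  have hiteratedFDeriv : iteratedFDeriv ℝ 2 (lift f) z = iteratedFDeriv ℝ 2 (lift f) z' := by
    simpa only [hperiod, add_sub_cancel] using
      (iteratedFDeriv_comp_add_right (𝕜 := ℝ) (f := lift f) 2 (z - z') z').symm
  simp only [drift, gradient, hfderiv, hiteratedFDeriv,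
    InnerProductSpace.laplacian_eq_iteratedFDeriv_orthonormalBasis (lift f)
      (EuclideanSpace.basisFun (Fin 2) ℝ)]

end Periodicity

section Consistency

/-- The coupling constant `|log ε|^{-1/2}`. -/
def coupling (ε : ℝ) : ℝ := |log ε| ^ (-(1 / 2) : ℝ)

theorem abs_log_pos {ε : ℝ} (hε : ε ∈ Set.Ioo 0 1) : 0 < |log ε| :=
  abs_pos.2 (log_neg hε.1 hε.2).ne

theorem coupling_pos {ε : ℝ} (hε : ε ∈ Set.Ioo 0 1) : 0 < coupling ε :=
  rpow_pos_of_pos (abs_log_pos hε) _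

/-- The second directional derivative and the squared directional derivative of `f`, combined as in
the equation satisfied by the Hopf–Cole transform `exp (coupling ε * f)`. -/
def lineDrift (ε : ℝ) (f : Torus → ℝ) (z d : Plane) : ℝ :=
  iteratedFDeriv ℝ 2 (lift f) z ![d, d] + coupling ε * fderiv ℝ (lift f) z d ^ 2

/-- The Hopf–Cole transform of `f` along the line through `z` with direction `d`, relative to its
value at `z`. -/
def lineExp (ε : ℝ) (f : Torus → ℝ) (z d : Plane) (r : ℝ) : ℝ :=
  exp (coupling ε * (lift f (z + r • d) - lift f z))

theorem step_eq_smul (r : ℝ) (e : Bool × Bool) : step r e = r • step 1 e := by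
  ext i
  fin_cases i <;> simp [step]

theorem step_one_eq (e : Bool × Bool) : step 1 e = sgn e.1 • EuclideanSpace.basisFun (Fin 2) ℝ 0
    + sgn e.2 • EuclideanSpace.basisFun (Fin 2) ℝ 1 := by
  ext i
  fin_cases i <;> simp [step]

theorem expect_lineDrift (ε : ℝ) (f : Torus → ℝ) (z : Plane) :
    𝔼 e, lineDrift ε f z (step 1 e) = 2 * drift ε f z := by
  set b := EuclideanSpace.basisFun (Fin 2) ℝ
  have hgrad : ‖∇ (lift f) z‖ ^ 2 =
      fderiv ℝ (lift f) z (b 0) ^ 2 + fderiv ℝ (lift f) z (b 1) ^ 2 := by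
    rw [← b.sum_sq_norm_inner_right, Fin.sum_univ_two]
    simp only [inner_gradient_right, conj_trivial, norm_eq_abs, sq_abs]
  rw [drift, InnerProductSpace.laplacian_eq_iteratedFDeriv_orthonormalBasis (lift f) b, hgrad,
    Fintype.expect_eq_sum_div_card]
  simp only [Fintype.sum_prod_type, Fintype.sum_bool, lineDrift, step_one_eq, sgn,
    iteratedFDeriv_two_apply, Fin.sum_univ_two, if_true, Bool.false_eq_true, if_false,
    Matrix.cons_val_zero, Matrix.cons_val_one, map_add, map_smul, add_apply,
    smul_apply, smul_eq_mul, Fintype.card_prod, Fintype.card_bool]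
  rw [coupling]
  push_cast
  ring

theorem expect_fderiv_step (f : Torus → ℝ) (z : Plane) :
    𝔼 e, fderiv ℝ (lift f) z (step 1 e) = 0 := by
  simp only [Fintype.expect_eq_sum_div_card, Fintype.sum_prod_type, Fintype.sum_bool, step_one_eq,
    sgn, if_true, Bool.false_eq_true, if_false, map_add, map_smul, smul_eq_mul]
  ring

section Line

variable {f : Torus → ℝ} (hf : ContDiff ℝ 2 (lift f)) (ε : ℝ) (z d : Plane) (r : ℝ)
include hf

theorem hasDerivAt_lift_line :
    HasDerivAt (fun r : ℝ => lift f (z + r • d)) (fderiv ℝ (lift f) (z + r • d) d) r :=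
  (hf.differentiable two_ne_zero _).hasFDerivAt.comp_hasDerivAt r <| by
    simpa using ((hasDerivAt_id r).smul_const d).const_add z

theorem hasDerivAt_fderiv_line :
    HasDerivAt (fun r : ℝ => fderiv ℝ (lift f) (z + r • d) d)
      (iteratedFDeriv ℝ 2 (lift f) (z + r • d) ![d, d]) r := by
  have hdiff : Differentiable ℝ (fderiv ℝ (lift f)) :=
    (hf.fderiv_right (m := 1) (by norm_num)).differentiable one_ne_zero
  have hline : HasDerivAt (fun r : ℝ => z + r • d) d r := by
    simpa using ((hasDerivAt_id r).smul_const d).const_add z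
  rw [iteratedFDeriv_two_apply]
  exact (ContinuousLinearMap.apply ℝ ℝ d).hasFDerivAt.comp_hasDerivAt r
    ((hdiff _).hasFDerivAt.comp_hasDerivAt r hline)

theorem hasDerivAt_lineExp :
    HasDerivAt (lineExp ε f z d)
      (coupling ε * fderiv ℝ (lift f) (z + r • d) d * lineExp ε f z d r) r :=
  ((((hasDerivAt_lift_line hf z d r).sub_const (lift f z)).const_mul
    (coupling ε)).exp).congr_deriv (mul_comm _ _)

theorem hasDerivAt_deriv_lineExp :
    HasDerivAt (fun r => coupling ε * fderiv ℝ (lift f) (z + r • d) d * lineExp ε f z d r)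
      (coupling ε * lineDrift ε f (z + r • d) d * lineExp ε f z d r) r := by
  refine (((hasDerivAt_fderiv_line hf z d r).const_mul (coupling ε)).mul
    (hasDerivAt_lineExp hf ε z d r)).congr_deriv ?_
  rw [lineDrift]
  ring

end Line

/-- A time-dependent field on the torus which is twice continuously differentiable in space, with
jointly continuous derivatives: the path regularity required of a solution. -/
structure IsC2Field (H : ℝ≥0 → Torus → ℝ) : Prop where
  contDiff : ∀ t, ContDiff ℝ 2 (lift (H t))
  continuous_iteratedFDeriv : ∀ k : ℕ, k ≤ 2 → Continuous fun p : ℝ≥0 × Plane =>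
    iteratedFDeriv ℝ k (lift (H p.1)) p.2

namespace IsC2Field

variable {H : ℝ≥0 → Torus → ℝ} (hH : IsC2Field H) (ε : ℝ)
include hH

theorem continuous_lift : Continuous fun p : ℝ≥0 × Plane => lift (H p.1) p.2 := by
  simpa [Function.comp_def] using
    (ContinuousMultilinearMap.apply ℝ (fun _ : Fin 0 => Plane) ℝ 0).continuous.comp
      (hH.continuous_iteratedFDeriv 0 zero_le_two)

theorem continuous_lineDrift (d : Plane) :
    Continuous fun p : ℝ≥0 × Plane => lineDrift ε (H p.1) p.2 d := by
  have hfirst : Continuous fun p : ℝ≥0 × Plane => fderiv ℝ (lift (H p.1)) p.2 d := by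
    simpa [Function.comp_def, iteratedFDeriv_one_apply] using
      (ContinuousMultilinearMap.apply ℝ (fun _ : Fin 1 => Plane) ℝ ![d]).continuous.comp
        (hH.continuous_iteratedFDeriv 1 one_le_two)
  exact ((ContinuousMultilinearMap.apply ℝ (fun _ : Fin 2 => Plane) ℝ ![d, d]).continuous.comp
    (hH.continuous_iteratedFDeriv 2 le_rfl)).add (continuous_const.mul (hfirst.pow 2))

theorem continuous_drift : Continuous fun p : ℝ≥0 × Plane => drift ε (H p.1) p.2 := by
  have hdrift (p : ℝ≥0 × Plane) : drift ε (H p.1) p.2 =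
      (∑ e, lineDrift ε (H p.1) p.2 (step 1 e)) / Fintype.card (Bool × Bool) / 2 := by
    rw [← Fintype.expect_eq_sum_div_card, expect_lineDrift, mul_div_cancel_left₀ _ two_ne_zero]
  simp only [hdrift]
  exact ((continuous_finsetSum _ fun e _ => hH.continuous_lineDrift ε _).div_const _).div_const _

theorem continuous_drift_toNNReal (z : Plane) :
    Continuous fun τ : ℝ => drift ε (H τ.toNNReal) z := by
  have htime : Continuous fun τ : ℝ => (τ.toNNReal, z) := by fun_prop
  simpa only [Function.comp_def] using (hH.continuous_drift ε).comp htime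

section Compact

variable {K : Set (ℝ≥0 × Plane)} (hK : IsCompact K) {η : ℝ} (hη : 0 < η)
include hK hη

theorem eventually_abs_lineExp_sub_le (d : Plane) :
    ∀ᶠ r in 𝓝[≥] 0, ∀ p ∈ K, |lineExp ε (H p.1) p.2 d r -
      (1 + r * (coupling ε * fderiv ℝ (lift (H p.1)) p.2 d) +
        r ^ 2 / 2 * (coupling ε * lineDrift ε (H p.1) p.2 d))| ≤ η * r ^ 2 := by
  have hcont : Continuous fun q : ℝ × ℝ≥0 × Plane =>
      coupling ε * lineDrift ε (H q.2.1) (q.2.2 + q.1 • d) d * lineExp ε (H q.2.1) q.2.2 d q.1 := by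
    have hshift : Continuous fun q : ℝ × ℝ≥0 × Plane => (q.2.1, q.2.2 + q.1 • d) := by fun_prop
    exact (continuous_const.mul ((hH.continuous_lineDrift ε d).comp hshift)).mul
      (continuous_exp.comp (continuous_const.mul
        ((hH.continuous_lift.comp hshift).sub (hH.continuous_lift.comp continuous_snd))))
  have hmodulus := eventually_forall_mem_Icc (eventually_abs_sub_le hK hcont hη)
  filter_upwards [eventually_nhdsWithin_of_eventually_nhds hmodulus, self_mem_nhdsWithin]
    with r hr hr0 p hp
  simpa [lineExp] using abs_sub_taylor_le hr0
    (hasDerivAt_lineExp (hH.contDiff p.1) ε p.2 d)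
    (hasDerivAt_deriv_lineExp (hH.contDiff p.1) ε p.2 d)
    (c := coupling ε * lineDrift ε (H p.1) p.2 d) fun x hx => by simpa [lineExp] using hr x hx p hp

theorem eventually_abs_expect_lineExp_sub_le :
    ∀ᶠ r in 𝓝[≥] 0, ∀ p ∈ K, |𝔼 e, lineExp ε (H p.1) p.2 (step 1 e) r -
      (1 + r ^ 2 * (coupling ε * drift ε (H p.1) p.2))| ≤ η * r ^ 2 := by
  filter_upwards [eventually_all.2 fun e : Bool × Bool =>
    hH.eventually_abs_lineExp_sub_le ε hK hη (step 1 e)] with r hr p hp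
  have htaylor : 1 + r ^ 2 * (coupling ε * drift ε (H p.1) p.2) =
      𝔼 e, (1 + r * (coupling ε * fderiv ℝ (lift (H p.1)) p.2 (step 1 e)) +
        r ^ 2 / 2 * (coupling ε * lineDrift ε (H p.1) p.2 (step 1 e))) := by
    simp only [Finset.expect_add_distrib, ← Finset.mul_expect, expect_fderiv_step,
      expect_lineDrift, Fintype.expect_const]
    ring
  rw [htaylor, ← Finset.expect_sub_distrib]
  exact (Finset.abs_expect_le _ _).trans
    (Finset.expect_le Finset.univ_nonempty fun e _ => hr e p hp)

theorem eventually_abs_integral_drift_sub_le :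
    ∀ᶠ δ in 𝓝[≥] (0 : ℝ), ∀ p ∈ K, |(∫ τ in (p.1 : ℝ)..(p.1 + δ), drift ε (H τ.toNNReal) p.2) -
      δ * drift ε (H p.1) p.2| ≤ η * δ := by
  have hcont : Continuous fun q : ℝ × ℝ≥0 × Plane =>
      drift ε (H (q.2.1 + q.1).toNNReal) q.2.2 := by
    have htime : Continuous fun q : ℝ × ℝ≥0 × Plane => ((q.2.1 + q.1).toNNReal, q.2.2) := by
      fun_prop
    simpa only [Function.comp_def] using (hH.continuous_drift ε).comp htime
  have hmodulus := eventually_forall_mem_Icc (eventually_abs_sub_le hK hcont hη)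
  filter_upwards [eventually_nhdsWithin_of_eventually_nhds hmodulus, self_mem_nhdsWithin]
    with δ hδ hδ0 p hp
  have hδ0 : 0 ≤ δ := hδ0
  have hconst : δ * drift ε (H p.1) p.2 = ∫ _ in (p.1 : ℝ)..(p.1 + δ), drift ε (H p.1) p.2 := by
    rw [intervalIntegral.integral_const, add_sub_cancel_left, smul_eq_mul]
  rw [hconst, ← intervalIntegral.integral_sub
    ((hH.continuous_drift_toNNReal ε p.2).intervalIntegrable _ _)
    (continuous_const.intervalIntegrable _ _)]
  have hbound := intervalIntegral.norm_integral_le_of_norm_le_const (a := (p.1 : ℝ)) (b := p.1 + δ)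
    (C := η) (f := fun τ => drift ε (H τ.toNNReal) p.2 - drift ε (H p.1) p.2) fun τ hτ => by
      rw [Set.uIoc_of_le (by linarith)] at hτ
      simpa using hδ (τ - p.1) ⟨by linarith [hτ.1], by linarith [hτ.2]⟩ p hp
  rwa [add_sub_cancel_left, abs_of_nonneg hδ0] at hbound

theorem eventually_abs_logMeanExp_sub_le_of_isCompact :
    ∀ᶠ δ in 𝓝[≥] (0 : ℝ), ∀ p ∈ K,
      |logMeanExp (fun e => coupling ε * (lift (H p.1) (p.2 + step √δ e) - lift (H p.1) p.2)) -
        coupling ε * ∫ τ in (p.1 : ℝ)..(p.1 + δ), drift ε (H τ.toNNReal) p.2| ≤ η * δ := by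
  obtain ⟨ζ, hζ, rfl⟩ : ∃ ζ > 0, η = 2 * ζ + |coupling ε| * ζ :=
    ⟨η / (2 + |coupling ε|), by positivity, by field_simp⟩
  obtain ⟨B, hB⟩ := hK.exists_bound_of_continuousOn
    ((hH.continuous_drift ε).const_mul (coupling ε)).continuousOn
  have hsqrt : Tendsto (√·) (𝓝[≥] (0 : ℝ)) (𝓝[≥] 0) :=
    tendsto_nhdsWithin_iff.2 ⟨(continuous_sqrt.tendsto' 0 0 sqrt_zero).mono_left
      nhdsWithin_le_nhds, .of_forall sqrt_nonneg⟩
  filter_upwards [hsqrt.eventually (hH.eventually_abs_expect_lineExp_sub_le ε hK hζ),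
    hH.eventually_abs_integral_drift_sub_le ε hK hζ, eventually_abs_log_sub_le hζ B,
    self_mem_nhdsWithin] with δ hspace htime hlog hδ p hp
  have hspace := hspace p hp
  rw [sq_sqrt hδ] at hspace
  simp only [lineExp, ← step_eq_smul] at hspace
  have hlog := hlog _ _ (hB p hp) hspace
  have htime := mul_le_mul_of_nonneg_left (htime p hp) (abs_nonneg (coupling ε))
  rw [abs_sub_comm, ← abs_mul] at htime
  calc _ = |logMeanExp (fun e => coupling ε *
            (lift (H p.1) (p.2 + step √δ e) - lift (H p.1) p.2)) -
          δ * (coupling ε * drift ε (H p.1) p.2) +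
        coupling ε * (δ * drift ε (H p.1) p.2 -
          ∫ τ in (p.1 : ℝ)..(p.1 + δ), drift ε (H τ.toNNReal) p.2)| := by
        congr 1
        ring
    _ ≤ _ := (abs_add_le _ _).trans (add_le_add hlog htime)
    _ = _ := by ring

end Compact

theorem eventually_abs_logMeanExp_sub_le {η : ℝ} (hη : 0 < η) (T : ℝ≥0) :
    ∀ᶠ δ in 𝓝[≥] (0 : ℝ), ∀ s ≤ T, ∀ z,
      |logMeanExp (fun e => coupling ε * (lift (H s) (z + step √δ e) - lift (H s) z)) -
        coupling ε * ∫ τ in (s : ℝ)..(s + δ), drift ε (H τ.toNNReal) z| ≤ η * δ := by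
  filter_upwards [hH.eventually_abs_logMeanExp_sub_le_of_isCompact ε
    ((isCompact_Icc (a := 0) (b := T)).prod (isCompact_closedBall (0 : Plane) 1)) hη]
    with δ hδ s hs z
  have hz : toTorus z = toTorus (cellRep (toTorus z)) := (toTorus_cellRep _).symm
  have hlift : lift (H s) z = lift (H s) (cellRep (toTorus z)) := congrArg (H s) hz
  simpa only [hlift, lift_add_eq hz, drift_eq_of_toTorus_eq hz] using
    hδ (s, cellRep (toTorus z)) ⟨⟨zero_le, hs⟩, cellRep_mem_closedBall _⟩

end IsC2Field

end Consistency

section Stability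

theorem abs_logMeanExp_sub_le {J : Type*} [Fintype J] [Nonempty J] {y z : J → ℝ} {c : ℝ}
    (h : ∀ j, |y j - z j| ≤ c) : |logMeanExp y - logMeanExp z| ≤ c := by
  have hupper := logMeanExp_mono fun j => show y j ≤ z j + c by linarith [(abs_le.1 (h j)).2]
  have hlower := logMeanExp_mono fun j => show z j ≤ y j + c by linarith [(abs_le.1 (h j)).1]
  rw [logMeanExp_add_const] at hupper hlower
  rw [abs_le]
  constructor <;> linarith

variable {G : Type*} [AddCommGroup G] {E : Type*} [Fintype E] [Nonempty E]

theorem log_evolution_succ (f : ℕ → G → ℝ) (σ : E → G) (n : ℕ) (z : G) :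
    log (evolution f σ (n + 1) z) =
      f n z + logMeanExp fun e => log (evolution f σ n (z + σ e)) := by
  simp only [evolution, logMeanExp, exp_log (evolution_pos _ _ _ _)]
  rw [log_mul (exp_pos _).ne' (Finset.expect_pos (fun _ _ => evolution_pos _ _ _ _)
    Finset.univ_nonempty).ne', log_exp]

theorem abs_log_evolution_sub_le {f V : ℕ → G → ℝ} {σ : E → G} {Z : Set G}
    (hZ : ∀ z ∈ Z, ∀ e, z + σ e ∈ Z) {n : ℕ} {κ : ℝ} (hzero : ∀ z ∈ Z, V 0 z = 0)
    (hstep : ∀ k < n, ∀ z ∈ Z,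
      |f k z + logMeanExp (fun e => V k (z + σ e)) - V (k + 1) z| ≤ κ) :
    ∀ k ≤ n, ∀ z ∈ Z, |log (evolution f σ k z) - V k z| ≤ k * κ := by
  intro k
  induction k with
  | zero => simpa [evolution] using hzero
  | succ k ih =>
    intro hk z hz
    have hprevious := abs_le.1 <| abs_logMeanExp_sub_le fun e =>
      ih (Nat.le_of_succ_le hk) (z + σ e) (hZ z hz e)
    have hlocal := abs_le.1 (hstep k hk z hz)
    rw [log_evolution_succ, abs_le]
    push_cast
    constructor <;> linarith [hprevious.1, hprevious.2, hlocal.1, hlocal.2]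

end Stability

section Convergence

/-- The point with coordinates `q` of the square lattice of mesh `r` based at `z`. -/
def latticePoint (z : Plane) (r : ℝ) (q : ℤ × ℤ) : Plane := z + !₂[r * q.1, r * q.2]

theorem latticePoint_zero (z : Plane) (r : ℝ) : latticePoint z r 0 = z := by
  ext i
  fin_cases i <;> simp [latticePoint]

theorem latticePoint_add_step (z : Plane) (r : ℝ) (q : ℤ × ℤ) (e : Bool × Bool) :
    latticePoint z r q + step r e =
      latticePoint z r (q.1 + if e.1 then 1 else -1, q.2 + if e.2 then 1 else -1) := by
  obtain ⟨e₁, e₂⟩ := e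
  ext i
  fin_cases i
  · cases e₁ <;> simp [latticePoint, step, sgn] <;> ring
  · cases e₂ <;> simp [latticePoint, step, sgn] <;> ring

namespace IsC2Field

variable {H : ℝ≥0 → Torus → ℝ} (hH : IsC2Field H) {N : ℝ≥0 → Plane → ℝ} (ε : ℝ)
include hH

theorem abs_log_evolution_sub_le {Z : Set Plane} {δ : ℝ≥0} {n : ℕ} {η : ℝ}
    (hZ : ∀ w ∈ Z, ∀ e, w + step √δ e ∈ Z) (hzero : ∀ w ∈ Z, N 0 w = 0)
    (hequation : ∀ k : ℕ, ∀ w ∈ Z, lift (H (k * δ)) w =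
      (∫ τ in (0 : ℝ)..(k * δ : ℝ≥0), drift ε (H τ.toNNReal) w) + N (k * δ) w)
    (hstep : ∀ k < n, ∀ w ∈ Z,
      |logMeanExp (fun e => coupling ε *
          (lift (H (k * δ)) (w + step √δ e) - lift (H (k * δ)) w)) -
        coupling ε * ∫ τ in ((k * δ : ℝ≥0) : ℝ)..((k * δ : ℝ≥0) + δ),
          drift ε (H τ.toNNReal) w| ≤ η)
    {z : Plane} (hz : z ∈ Z) :
    |log (evolution (fun k w => coupling ε * (N ((k + 1 : ℕ) * δ) w - N (k * δ) w))
      (step √δ) n z) - coupling ε * lift (H (n * δ)) z| ≤ n * η := by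
  have hstart (w : Plane) (hw : w ∈ Z) : lift (H 0) w = 0 := by
    simpa [hzero w hw] using hequation 0 w hw
  refine KPZ.abs_log_evolution_sub_le (V := fun k w => coupling ε * lift (H (k * δ)) w) hZ
    (fun w hw => by simp [hstart w hw]) (fun k hk w hw => ?_) n le_rfl z hz
  have hcenter (e : Bool × Bool) : coupling ε * lift (H (k * δ)) (w + step √δ e) =
      coupling ε * (lift (H (k * δ)) (w + step √δ e) - lift (H (k * δ)) w) +
        coupling ε * lift (H (k * δ)) w := by
    ring
  have hincrement := intervalIntegral.integral_interval_sub_left (μ := volume)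
    ((hH.continuous_drift_toNNReal ε w).intervalIntegrable 0 (((k + 1 : ℕ) * δ : ℝ≥0) : ℝ))
    ((hH.continuous_drift_toNNReal ε w).intervalIntegrable 0 ((k * δ : ℝ≥0) : ℝ))
  have htime : ((k * δ : ℝ≥0) : ℝ) + δ = ((k + 1 : ℕ) * δ : ℝ≥0) := by
    push_cast
    ring
  have hlocal := hstep k hk w hw
  rw [htime, ← hincrement] at hlocal
  simp only [hcenter]
  rw [logMeanExp_add_const, hequation k w hw, hequation (k + 1) w hw]
  convert hlocal using 2
  rw [hequation k w hw]
  ring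

theorem tendsto_log_evolution (t : ℝ≥0) (z : Plane)
    (hzero : ∀ (n : ℕ) q, N 0 (latticePoint z √(t / n : ℝ≥0) q) = 0)
    (hequation : ∀ (n k : ℕ) q, lift (H (k * (t / n))) (latticePoint z √(t / n : ℝ≥0) q) =
      (∫ τ in (0 : ℝ)..(k * (t / n) : ℝ≥0),
        drift ε (H τ.toNNReal) (latticePoint z √(t / n : ℝ≥0) q)) +
      N (k * (t / n)) (latticePoint z √(t / n : ℝ≥0) q)) :
    Tendsto (fun n : ℕ => log (evolution
      (fun k w => coupling ε * (N ((k + 1 : ℕ) * (t / n)) w - N (k * (t / n)) w))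
      (step √(t / n : ℝ≥0)) n z)) atTop (𝓝 (coupling ε * lift (H t) z)) := by
  rw [Metric.tendsto_nhds]
  intro ζ hζ
  have hη : 0 < ζ / (t + 1) := by positivity
  have hmesh : Tendsto (fun n : ℕ => ((t / n : ℝ≥0) : ℝ)) atTop (𝓝[≥] 0) :=
    tendsto_nhdsWithin_iff.2 ⟨by simpa using tendsto_const_div_atTop_nhds_zero_nat (t : ℝ),
      .of_forall fun n => NNReal.coe_nonneg _⟩
  filter_upwards [hmesh.eventually (hH.eventually_abs_logMeanExp_sub_le ε hη t),
    eventually_ne_atTop 0] with n hn hn0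
  have hnt : (n : ℝ≥0) * (t / n) = t := mul_div_cancel₀ t (by exact_mod_cast hn0)
  have hbound := hH.abs_log_evolution_sub_le ε (n := n)
    (Z := Set.range (latticePoint z √(t / n : ℝ≥0)))
    (by rintro _ ⟨q, rfl⟩ e; exact ⟨_, (latticePoint_add_step z _ q e).symm⟩)
    (Set.forall_mem_range.2 (hzero n)) (fun k => Set.forall_mem_range.2 (hequation n k))
    (fun k hk w _ => hn _ ((mul_le_mul_left (Nat.cast_le.2 hk.le) _).trans_eq hnt) w)
    ⟨0, latticePoint_zero z _⟩
  have hnt' : (n : ℝ) * (t / n : ℝ≥0) = t := by exact_mod_cast congrArg NNReal.toReal hnt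
  rw [hnt, mul_left_comm, hnt'] at hbound
  refine hbound.trans_lt ?_
  rw [div_mul_eq_mul_div, div_lt_iff₀ (by positivity)]
  nlinarith

end IsC2Field

variable {Ω : Type*} [MeasurableSpace Ω] {P : Measure Ω}
  {W : ℝ≥0 → Lp ℝ 2 (volume : Measure Torus) → Ω → ℝ} {ρ : Mollifier} {ε θ : ℝ}
  {h : ℝ≥0 → Torus → Ω → ℝ}

theorem IsCylindricalWiener.ae_zero (hW : IsCylindricalWiener W P)
    (f : Lp ℝ 2 (volume : Measure Torus)) : W 0 f =ᵐ[P] 0 := by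
  have hvariance := hW.covariance 0 0 f f
  rw [min_self, NNReal.coe_zero, zero_mul, integral_eq_zero_iff_of_nonneg
    (fun ω => mul_self_nonneg _) (hW.integrable_mul (mem_noiseSpan _ _) (mem_noiseSpan _ _))]
    at hvariance
  filter_upwards [hvariance] with ω hω
  simpa using hω

theorem IsSolution.ae_isC2Field (hsol : IsSolution ρ W P ε θ h) :
    ∀ᵐ ω ∂P, IsC2Field fun t x => h t x ω := by
  filter_upwards [hsol.contDiff, hsol.continuous_derivatives] with ω hcontDiff hcontinuous
  exact ⟨hcontDiff, hcontinuous⟩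

theorem IsSolution.tendsto_log_evolution (hW : IsCylindricalWiener W P)
    (hsol : IsSolution ρ W P ε θ h) (t : ℝ≥0) (z : Plane) :
    ∀ᵐ ω ∂P, Tendsto (fun n : ℕ => log (evolution
      (noiseStep ρ W ε (coupling ε * √θ) (t / n) ω) (step √(t / n : ℝ≥0)) n z))
      atTop (𝓝 (coupling ε * h t (toTorus z) ω)) := by
  have hequation := ae_all_iff.2 fun n : ℕ => ae_all_iff.2 fun k : ℕ => ae_all_iff.2 fun q =>
    hsol.equation (k * (t / n)) (latticePoint z √(t / n : ℝ≥0) q)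
  have hzero := ae_all_iff.2 fun n : ℕ => ae_all_iff.2 fun q =>
    hW.ae_zero (ρ.shiftL2 ε (toTorus (latticePoint z √(t / n : ℝ≥0) q)))
  filter_upwards [hsol.ae_isC2Field, hequation, hzero] with ω hH hequation hzero
  have hlimit := hH.tendsto_log_evolution ε (N := fun s w =>
    √θ * mollifiedNoise ρ W ε s (toTorus w) ω) t z
    (fun n q => by rw [mollifiedNoise, hzero, Pi.zero_apply, mul_zero]) hequation
  simp only [← mul_sub, ← mul_assoc] at hlimit
  exact hlimit

end Convergence

section FreeEnergy

theorem exp_logMeanExp_hamiltonian {Ω J : Type*} [Fintype J] [Nonempty J] (H : J → Ω → ℝ)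
    (C : J → J → ℝ) (ω : Ω) :
    exp (logMeanExp (hamiltonian H C 0 1 ω)) =
      (∑ j, exp (H j ω) * exp (-(C j j / 2))) / Fintype.card J := by
  rw [logMeanExp, exp_log (expect_exp_pos _), Fintype.expect_eq_sum_div_card]
  simp only [hamiltonian, ← exp_add, Pi.zero_apply, one_mul, one_pow, add_zero, sub_eq_add_neg]

variable {Ω : Type*} [MeasurableSpace Ω] {P : Measure Ω}

theorem integral_exp_of_hasGaussianLaw {X : Ω → ℝ} (hX : HasGaussianLaw X P)
    (h0 : ∫ ω, X ω ∂P = 0) : ∫ ω, exp (X ω) ∂P = exp ((∫ ω, X ω * X ω ∂P) / 2) := by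
  have hmgf := mgf_gaussianReal hX.map_eq_gaussianReal 1
  rw [variance_of_integral_eq_zero hX.aemeasurable h0, h0,
    Real.coe_toNNReal _ (integral_nonneg fun ω => sq_nonneg _)] at hmgf
  simpa only [mgf, sq, one_mul, zero_mul, zero_add, mul_one] using hmgf

theorem integrable_exp_of_hasGaussianLaw {X : Ω → ℝ} (hX : HasGaussianLaw X P)
    (h0 : ∫ ω, X ω ∂P = 0) : Integrable (fun ω => exp (X ω)) P :=
  .of_integral_ne_zero ((integral_exp_of_hasGaussianLaw hX h0).trans_ne (exp_pos _).ne')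

section Hamiltonian

variable {J : Type*} [Fintype J] [Nonempty J] {H : J → Ω → ℝ} {C : J → J → ℝ}

theorem integrable_exp_logMeanExp_hamiltonian (hH : HasGaussianLaw (fun ω j => H j ω) P)
    (h0 : ∀ j, ∫ ω, H j ω ∂P = 0) :
    Integrable (fun ω => exp (logMeanExp (hamiltonian H C 0 1 ω))) P := by
  simp only [exp_logMeanExp_hamiltonian]
  exact (integrable_finsetSum _ fun j _ =>
    (integrable_exp_of_hasGaussianLaw (hH.eval j) (h0 j)).mul_const _).div_const _

theorem integral_exp_logMeanExp_hamiltonian (hH : HasGaussianLaw (fun ω j => H j ω) P)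
    (h0 : ∀ j, ∫ ω, H j ω ∂P = 0) (hC : ∀ j, ∫ ω, H j ω * H j ω ∂P = C j j) :
    ∫ ω, exp (logMeanExp (hamiltonian H C 0 1 ω)) ∂P = 1 := by
  have hterm (j : J) : ∫ ω, exp (H j ω) * exp (-(C j j / 2)) ∂P = 1 := by
    rw [integral_mul_const, integral_exp_of_hasGaussianLaw (hH.eval j) (h0 j), hC, ← exp_add,
      add_neg_cancel, exp_zero]
  simp only [exp_logMeanExp_hamiltonian]
  rw [integral_div, integral_finsetSum _ fun j _ =>
    (integrable_exp_of_hasGaussianLaw (hH.eval j) (h0 j)).mul_const _]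
  simp [hterm]

end Hamiltonian

section Limit

theorem map_eq_of_ae_tendsto [IsProbabilityMeasure P] {S : Type*} [TopologicalSpace S]
    [TopologicalSpace.PseudoMetrizableSpace S] [MeasurableSpace S] [BorelSpace S]
    {F G : ℕ → Ω → S} {f g : Ω → S}
    (hF : ∀ n, AEMeasurable (F n) P) (hG : ∀ n, AEMeasurable (G n) P)
    (hFf : ∀ᵐ ω ∂P, Tendsto (F · ω) atTop (𝓝 (f ω)))
    (hGg : ∀ᵐ ω ∂P, Tendsto (G · ω) atTop (𝓝 (g ω)))
    (hFG : ∀ n, P.map (F n) = P.map (G n)) : P.map f = P.map g := by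
  have hf := aemeasurable_of_tendsto_metrizable_ae atTop hF hFf
  have hg := aemeasurable_of_tendsto_metrizable_ae atTop hG hGg
  have hlimit := (tendstoInDistribution_of_ae_tendsto hG hg hGg).tendsto
  exact tendstoInDistribution_unique F (tendstoInDistribution_of_ae_tendsto hF hf hFf)
    ⟨hF, hg, hlimit.congr fun n => Subtype.ext (hFG n).symm⟩

theorem integral_norm_le_two_mul_integral_exp_sub {F : Ω → ℝ} (hF : Integrable F P)
    (hexp : Integrable (fun ω => exp (F ω)) P) :
    ∫ ω, ‖F ω‖ ∂P ≤ 2 * ∫ ω, exp (F ω) ∂P - ∫ ω, F ω ∂P := by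
  rw [← integral_const_mul, ← integral_sub (hexp.const_mul 2) hF]
  refine integral_mono hF.norm ((hexp.const_mul 2).sub hF) fun ω => ?_
  have hlt := add_one_le_exp (F ω)
  have hpos := exp_pos (F ω)
  rw [norm_eq_abs, abs_le']
  constructor <;> linarith

theorem eLpNorm_one_eq_ofReal_integral_norm {f : Ω → ℝ} (hf : Integrable f P) :
    eLpNorm f 1 P = ENNReal.ofReal (∫ ω, ‖f ω‖ ∂P) := by
  rw [eLpNorm_one_eq_lintegral_enorm, ofReal_integral_norm_eq_lintegral_enorm hf]

variable {F : ℕ → Ω → ℝ} {f : Ω → ℝ} {B : ℝ}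

theorem eLpNorm_one_le_of_ae_tendsto (hF : ∀ n, Integrable (F n) P)
    (hbound : ∀ᶠ n in atTop, ∫ ω, ‖F n ω‖ ∂P ≤ B)
    (hlim : ∀ᵐ ω ∂P, Tendsto (F · ω) atTop (𝓝 (f ω))) :
    eLpNorm f 1 P ≤ ENNReal.ofReal B := by
  refine (Lp.eLpNorm_lim_le_liminf_eLpNorm (fun n => (hF n).aestronglyMeasurable) f hlim).trans
    (liminf_le_of_frequently_le' (hbound.mono fun n hn => ?_).frequently)
  rw [eLpNorm_one_eq_ofReal_integral_norm (hF n)]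
  exact ENNReal.ofReal_le_ofReal hn

theorem integrable_of_ae_tendsto_of_integral_norm_le (hF : ∀ n, Integrable (F n) P)
    (hbound : ∀ᶠ n in atTop, ∫ ω, ‖F n ω‖ ∂P ≤ B)
    (hlim : ∀ᵐ ω ∂P, Tendsto (F · ω) atTop (𝓝 (f ω))) : Integrable f P :=
  memLp_one_iff_integrable.1
    ⟨aestronglyMeasurable_of_tendsto_ae _ (fun n => (hF n).aestronglyMeasurable) hlim,
      (eLpNorm_one_le_of_ae_tendsto hF hbound hlim).trans_lt ENNReal.ofReal_lt_top⟩

theorem integral_norm_le_of_ae_tendsto (hF : ∀ n, Integrable (F n) P)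
    (hbound : ∀ᶠ n in atTop, ∫ ω, ‖F n ω‖ ∂P ≤ B)
    (hlim : ∀ᵐ ω ∂P, Tendsto (F · ω) atTop (𝓝 (f ω))) : ∫ ω, ‖f ω‖ ∂P ≤ B := by
  obtain ⟨n, hn⟩ := hbound.exists
  have hB : 0 ≤ B := (integral_nonneg fun ω => norm_nonneg (F n ω)).trans hn
  rw [← ENNReal.ofReal_le_ofReal_iff hB, ← eLpNorm_one_eq_ofReal_integral_norm
    (integrable_of_ae_tendsto_of_integral_norm_le hF hbound hlim)]
  exact eLpNorm_one_le_of_ae_tendsto hF hbound hlim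

end Limit

end FreeEnergy

section Scheme

variable {Ω : Type*} {W : ℝ≥0 → Lp ℝ 2 (volume : Measure Torus) → Ω → ℝ} {E : Type*}
variable (ρ : Mollifier) (ε c : ℝ) (δ : ℝ≥0) (σ : E → Plane) (n : ℕ) (z : Plane)

/-- The covariance of the energies which two walks started from the same point collect in the
potential `noiseStep`: the noise is white in time, so only the difference of the walks matters. -/
def pathCovariance (p p' : Fin n → E) : ℝ :=
  pathEnergy (fun _ y => c ^ 2 * δ * ρ.corr ε y) (differenceStep σ) n (fun i => (p i, p' i)) 0

theorem pathCovariance_self (p : Fin n → E) :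
    pathCovariance ρ ε c δ σ n p p = n * (c ^ 2 * δ * ρ.corr ε 0) :=
  pathEnergy_differenceStep_self (fun y => c ^ 2 * δ * ρ.corr ε y) σ n p 0

theorem pathCovariance_nonneg (p p' : Fin n → E) : 0 ≤ pathCovariance ρ ε c δ σ n p p' :=
  pathEnergy_nonneg (fun _ y => mul_nonneg (by positivity) (ρ.corr_nonneg ε y)) _ _ _ _

theorem IsCylindricalWiener.integral_pathEnergy_mul_pathEnergy [MeasurableSpace Ω] {P : Measure Ω}
    (hW : IsCylindricalWiener W P) (p p' : Fin n → E) :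
    ∫ ω, pathEnergy (noiseStep ρ W ε c δ ω) σ n p z * pathEnergy (noiseStep ρ W ε c δ ω) σ n p' z
      ∂P = pathCovariance ρ ε c δ σ n p p' := by
  rw [hW.covariance_pathEnergy, sub_self, pathCovariance]

variable [Fintype E]

theorem logOverlapMoment_pathCovariance_le [Nonempty E] {n : ℕ}
    (hcorr : 2 * (c ^ 2 * δ * ρ.corr ε 0) ≤ 1)
    (hgreen : ∀ k ≤ n, ∀ y, 8 * (c ^ 2 * δ * green (ρ.corr ε) (differenceStep σ) k y) ≤ 1) :
    logOverlapMoment (pathCovariance ρ ε c δ σ n) ≤ log 2 := by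
  have hcoeff : 0 ≤ c ^ 2 * (δ : ℝ) := by positivity
  simp only [logOverlapMoment, pathCovariance]
  rw [expect_pair_exp_pathEnergy (fun y => c ^ 2 * δ * ρ.corr ε y)]
  refine log_le_log (evolution_pos _ _ _ _) (evolution_le_two
    (fun y => by have := ρ.corr_nonneg ε y; positivity) (fun y => ?_) _ (fun k hk y => ?_) _)
  · linarith [mul_le_mul_of_nonneg_left (ρ.corr_le ε y) hcoeff]
  · rw [green_const_mul, green_const_mul]
    linarith [hgreen k hk y]

/-- The logarithm of the discrete evolution in the potential `noiseStep`, recentred by half the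
variance of the path energies so that its exponential has mean one. -/
def freeEnergy (ρ : Mollifier) (W : ℝ≥0 → Lp ℝ 2 (volume : Measure Torus) → Ω → ℝ) (ε c : ℝ)
    (δ : ℝ≥0) (σ : E → Plane) (n : ℕ) (z : Plane) (ω : Ω) : ℝ :=
  log (evolution (noiseStep ρ W ε c δ ω) σ n z) - n * (c ^ 2 * δ * ρ.corr ε 0) / 2

variable [Nonempty E]

theorem freeEnergy_eq_logMeanExp (ω : Ω) :
    freeEnergy ρ W ε c δ σ n z ω =
      logMeanExp (hamiltonian (fun p ω => pathEnergy (noiseStep ρ W ε c δ ω) σ n p z)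
        (pathCovariance ρ ε c δ σ n) 0 1 ω) := by
  rw [freeEnergy, log_evolution, sub_eq_add_neg, ← logMeanExp_add_const]
  congr 1 with p
  simp only [hamiltonian, pathCovariance_self, Pi.zero_apply]
  ring

namespace IsCylindricalWiener

variable [MeasurableSpace Ω] {P : Measure Ω} (hW : IsCylindricalWiener W P)
include hW

theorem integrable_freeEnergy [IsProbabilityMeasure P] :
    Integrable (freeEnergy ρ W ε c δ σ n z) P := by
  simp only [funext (freeEnergy_eq_logMeanExp (W := W) ρ ε c δ σ n z)]
  exact integrable_logMeanExp_hamiltonian fun p => hW.integrable (pathEnergy_mem ρ ε c δ σ n p z)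

theorem integrable_exp_freeEnergy :
    Integrable (fun ω => exp (freeEnergy ρ W ε c δ σ n z ω)) P := by
  simp only [freeEnergy_eq_logMeanExp]
  exact integrable_exp_logMeanExp_hamiltonian
    (hW.hasGaussianLaw fun p => pathEnergy_mem ρ ε c δ σ n p z)
    fun p => hW.integral_eq_zero (pathEnergy_mem ρ ε c δ σ n p z)

theorem integral_exp_freeEnergy : ∫ ω, exp (freeEnergy ρ W ε c δ σ n z ω) ∂P = 1 := by
  simp only [freeEnergy_eq_logMeanExp]
  exact integral_exp_logMeanExp_hamiltonian
    (hW.hasGaussianLaw fun p => pathEnergy_mem ρ ε c δ σ n p z)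
    (fun p => hW.integral_eq_zero (pathEnergy_mem ρ ε c δ σ n p z))
    fun p => hW.integral_pathEnergy_mul_pathEnergy ρ ε c δ σ n z p p

theorem neg_half_variance_le_integral_freeEnergy [IsProbabilityMeasure P] :
    -(n * (c ^ 2 * δ * ρ.corr ε 0) / 2) ≤ ∫ ω, freeEnergy ρ W ε c δ σ n z ω ∂P := by
  simp only [freeEnergy_eq_logMeanExp]
  exact neg_half_le_integral_logMeanExp
    (fun p => hW.integrable (pathEnergy_mem ρ ε c δ σ n p z))
    (fun p => hW.integral_eq_zero (pathEnergy_mem ρ ε c δ σ n p z))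
    fun p => (pathCovariance_self ρ ε c δ σ n p).le

theorem neg_log_two_le_integral_freeEnergy {n : ℕ}
    (hcorr : 2 * (c ^ 2 * δ * ρ.corr ε 0) ≤ 1)
    (hgreen : ∀ k ≤ n, ∀ y, 8 * (c ^ 2 * δ * green (ρ.corr ε) (differenceStep σ) k y) ≤ 1) :
    -((exp 1 - 1) / 2 * log 2) ≤ ∫ ω, freeEnergy ρ W ε c δ σ n z ω ∂P := by
  simp only [freeEnergy_eq_logMeanExp]
  refine le_trans ?_ (neg_logOverlapMoment_le_integral_logMeanExp
    (hW.hasGaussianLaw fun p => pathEnergy_mem ρ ε c δ σ n p z)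
    (fun p => hW.integral_eq_zero (pathEnergy_mem ρ ε c δ σ n p z))
    (hW.integral_pathEnergy_mul_pathEnergy ρ ε c δ σ n z) (pathCovariance_nonneg ρ ε c δ σ n))
  rw [neg_mul, neg_le_neg_iff]
  exact mul_le_mul_of_nonneg_left (logOverlapMoment_pathCovariance_le ρ ε c δ σ hcorr hgreen)
    (by linarith [add_one_le_exp 1])

theorem map_freeEnergy_eq (z' : Plane) :
    P.map (freeEnergy ρ W ε c δ σ n z) = P.map (freeEnergy ρ W ε c δ σ n z') := by
  have hgaussian (z : Plane) :=
    hW.hasGaussianLaw fun p : Fin n → E => pathEnergy_mem ρ ε c δ σ n p z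
  have hmean (z : Plane) (p : Fin n → E) :=
    hW.integral_eq_zero (pathEnergy_mem ρ ε c δ σ n p z)
  have henergies := map_eq_of_covariance_eq (hgaussian z) (hgaussian z')
    (fun p => (hmean z p).trans (hmean z' p).symm) fun p p' => by
      rw [covariance_eq_integral_mul (hgaussian z) (hmean z),
        covariance_eq_integral_mul (hgaussian z') (hmean z'),
        hW.integral_pathEnergy_mul_pathEnergy, hW.integral_pathEnergy_mul_pathEnergy]
  let Φ (y : (Fin n → E) → ℝ) : ℝ := logMeanExp y - n * (c ^ 2 * δ * ρ.corr ε 0) / 2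
  have hΦ : Measurable Φ := continuous_logMeanExp.measurable.sub_const _
  have hmap (z : Plane) : P.map (freeEnergy ρ W ε c δ σ n z) =
      (P.map fun ω p => pathEnergy (noiseStep ρ W ε c δ ω) σ n p z).map Φ := by
    rw [AEMeasurable.map_map_of_aemeasurable hΦ.aemeasurable (hgaussian z).aemeasurable]
    refine congrArg P.map (funext fun ω => ?_)
    rw [freeEnergy, log_evolution, Function.comp_apply]
  rw [hmap, hmap, henergies]

end IsCylindricalWiener

end Scheme

section Smallness

theorem coupling_sq (ε : ℝ) : coupling ε ^ 2 = |log ε|⁻¹ := by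
  rw [coupling, ← rpow_natCast, ← rpow_mul (abs_nonneg _), ← rpow_neg_one]
  norm_num

theorem abs_log_rpow_half (ε : ℝ) : |log ε| ^ (1 / 2 : ℝ) = (coupling ε)⁻¹ := by
  rw [coupling, rpow_neg (abs_nonneg _), inv_inv]

theorem log_natCeil_inv_le {ε : ℝ} (hε : ε ∈ Set.Ioo (0 : ℝ) 1) :
    log ⌈ε⁻¹⌉₊ ≤ |log ε| + 1 := by
  have hinv : 1 ≤ ε⁻¹ := (one_le_inv₀ hε.1).2 hε.2.le
  have hceil : (⌈ε⁻¹⌉₊ : ℝ) ≤ ε⁻¹ * exp 1 := by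
    nlinarith [Nat.ceil_lt_add_one (zero_le_one.trans hinv), add_one_le_exp 1]
  calc log ⌈ε⁻¹⌉₊ ≤ log (ε⁻¹ * exp 1) :=
        log_le_log (by exact_mod_cast Nat.ceil_pos.2 (inv_pos.2 hε.1)) hceil
    _ = |log ε| + 1 := by
        rw [log_mul (inv_pos.2 hε.1).ne' (exp_pos 1).ne', log_inv, log_exp,
          abs_of_neg (log_neg hε.1 hε.2)]

theorem Mollifier.corr_zero_div_natCeil_sq_le (ρ : Mollifier) {ε : ℝ}
    (hε : ε ∈ Set.Ioo (0 : ℝ) 1) :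
    ρ.corr ε 0 / (⌈ε⁻¹⌉₊ : ℝ) ^ 2 ≤ ∫ x, ρ.toFun x ^ 2 := by
  rw [ρ.corr_zero hε, div_div, ← mul_pow]
  refine div_le_self (integral_nonneg fun x => sq_nonneg _) (one_le_pow₀ ?_)
  exact (inv_le_iff_one_le_mul₀' hε.1).1 (Nat.le_ceil _)

-- The coupling constant beats the logarithm in the bound on the Green function, with the frequency
-- cutoff at `1 / ε`: the left-hand side tends to `8 θ (4 / π ^ 2)`.
theorem eventually_coupling_sq_mul_le (ρ : Mollifier) {θ : ℝ} (hθ : 0 ≤ θ) (hθ' : θ ≤ 1 / 100)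
    (t : ℝ) :
    ∀ᶠ ε in 𝓝[>] (0 : ℝ), 8 * (coupling ε ^ 2 * θ *
      (1 + (2 * t + 4 / π ^ 2 * (1 + log ⌈ε⁻¹⌉₊) + ρ.corr ε 0 / (⌈ε⁻¹⌉₊ : ℝ) ^ 2))) ≤ 1 := by
  have hlog := (tendsto_abs_atBot_atTop.comp tendsto_log_nhdsGT_zero).eventually_ge_atTop
    (3 + 2 * t + ∫ x, ρ.toFun x ^ 2)
  filter_upwards [hlog, Ioo_mem_nhdsGT one_pos] with ε hlog hε
  simp only [Function.comp_apply] at hlog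
  have hlogpos : 0 < |log ε| := abs_log_pos hε
  have hpi : 4 / π ^ 2 ≤ 1 := by
    rw [div_le_one (by positivity)]
    nlinarith [pi_gt_three]
  have hcutoff : 4 / π ^ 2 * (1 + log ⌈ε⁻¹⌉₊) ≤ 1 + log ⌈ε⁻¹⌉₊ :=
    mul_le_of_le_one_left (by linarith [log_natCast_nonneg ⌈ε⁻¹⌉₊]) hpi
  calc 8 * (coupling ε ^ 2 * θ * (1 + (2 * t + 4 / π ^ 2 * (1 + log ⌈ε⁻¹⌉₊) +
          ρ.corr ε 0 / (⌈ε⁻¹⌉₊ : ℝ) ^ 2)))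
      ≤ 8 * (|log ε|⁻¹ * θ * (2 * |log ε|)) := by
        rw [coupling_sq]
        gcongr
        linarith [log_natCeil_inv_le hε, ρ.corr_zero_div_natCeil_sq_le hε]
    _ = 16 * θ := by field_simp; ring
    _ ≤ 1 := by linarith

end Smallness

section Solution

variable {Ω : Type*} {W : ℝ≥0 → Lp ℝ 2 (volume : Measure Torus) → Ω → ℝ} {ρ : Mollifier}
  {ε θ : ℝ}

/-- The leading term of the expectation of the solution. -/
def renormalization (ρ : Mollifier) (ε θ : ℝ) (t : ℝ≥0) : ℝ :=
  1 / 2 * coupling ε * (θ * t / ε ^ 2) * ∫ x, ρ.toFun x ^ 2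

/-- The free energy of the random walk approximation with `n` steps to the equation on `[0, t]`. -/
def latticeFreeEnergy (ρ : Mollifier) (W : ℝ≥0 → Lp ℝ 2 (volume : Measure Torus) → Ω → ℝ)
    (ε θ : ℝ) (t : ℝ≥0) (z : Plane) (n : ℕ) (ω : Ω) : ℝ :=
  freeEnergy ρ W ε (coupling ε * √θ) (t / n) (step √(t / n : ℝ≥0)) n z ω

theorem coupling_mul_sqrt_sq_mul (ε : ℝ) (hθ : 0 ≤ θ) (t : ℝ≥0) (n : ℕ) :
    (coupling ε * √θ) ^ 2 * (t / n : ℝ≥0) = coupling ε ^ 2 * θ * (t / n) := by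
  rw [mul_pow, sq_sqrt hθ]
  push_cast
  rfl

theorem half_variance_eq (hε : ε ∈ Set.Ioo (0 : ℝ) 1) (hθ : 0 ≤ θ) (t : ℝ≥0) {n : ℕ}
    (hn : n ≠ 0) :
    n * ((coupling ε * √θ) ^ 2 * (t / n : ℝ≥0) * ρ.corr ε 0) / 2 =
      coupling ε * renormalization ρ ε θ t := by
  have hn' : (n : ℝ) ≠ 0 := by exact_mod_cast hn
  rw [coupling_mul_sqrt_sq_mul ε hθ, ρ.corr_zero hε, renormalization]
  field_simp

variable [MeasurableSpace Ω] {P : Measure Ω} {h : ℝ≥0 → Torus → Ω → ℝ}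

theorem IsSolution.tendsto_latticeFreeEnergy (hW : IsCylindricalWiener W P)
    (hsol : IsSolution ρ W P ε θ h) (hε : ε ∈ Set.Ioo (0 : ℝ) 1) (hθ : 0 ≤ θ) (t : ℝ≥0)
    (z : Plane) :
    ∀ᵐ ω ∂P, Tendsto (latticeFreeEnergy ρ W ε θ t z · ω) atTop
      (𝓝 (coupling ε * (h t (toTorus z) ω - renormalization ρ ε θ t))) := by
  filter_upwards [hsol.tendsto_log_evolution hW t z] with ω hω
  rw [mul_sub]
  refine (hω.sub_const _).congr' ?_
  filter_upwards [eventually_ne_atTop 0] with n hn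
  rw [latticeFreeEnergy, freeEnergy, half_variance_eq hε hθ t hn]

theorem IsCylindricalWiener.eventually_neg_log_two_le_integral_latticeFreeEnergy
    (hW : IsCylindricalWiener W P) (hε : ε ∈ Set.Ioo (0 : ℝ) 1) (hθ : 0 ≤ θ)
    {t : ℝ≥0} (ht : 0 < t) (z : Plane) {N : ℕ} (hN : 0 < N)
    (hsmall : 8 * (coupling ε ^ 2 * θ *
      (1 + (2 * t + 4 / π ^ 2 * (1 + log N) + ρ.corr ε 0 / N ^ 2))) ≤ 1) :
    ∀ᶠ n in atTop, -((exp 1 - 1) / 2 * log 2) ≤ ∫ ω, latticeFreeEnergy ρ W ε θ t z n ω ∂P := by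
  have hgreen := eventually_mul_green_le (A := fun m => ‖ρ.coeff ε m‖ ^ 2) (V := ρ.corr ε)
    (fun m => sq_nonneg _) (fun m => pow_le_one₀ (norm_nonneg _) (ρ.norm_coeff_le hε m))
    (ρ.hasSum_norm_coeff_sq ε) (ρ.hasSum_corr ε) (t := t) (by exact_mod_cast ht) hN
  have hstep : Tendsto (fun n : ℕ => 2 * coupling ε ^ 2 * θ * ρ.corr ε 0 * t / (n : ℝ))
    atTop (𝓝 0) := tendsto_const_div_atTop_nhds_zero_nat _
  filter_upwards [hgreen, hstep.eventually_le_const one_pos] with n hgreen hstep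
  refine hW.neg_log_two_le_integral_freeEnergy ρ ε _ _ _ z ?_ fun k hk y => ?_
  · rw [coupling_mul_sqrt_sq_mul ε hθ]
    linarith [show 2 * (coupling ε ^ 2 * θ * (t / n) * ρ.corr ε 0) =
      2 * coupling ε ^ 2 * θ * ρ.corr ε 0 * t / n by ring]
  · rw [coupling_mul_sqrt_sq_mul ε hθ, mul_assoc (coupling ε ^ 2 * θ)]
    refine le_trans ?_ hsmall
    gcongr
    exact hgreen k hk y

variable [IsProbabilityMeasure P]

namespace IsCylindricalWiener

variable (hW : IsCylindricalWiener W P)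
include hW

theorem integrable_latticeFreeEnergy (ρ : Mollifier) (ε θ : ℝ) (t : ℝ≥0) (z : Plane) (n : ℕ) :
    Integrable (latticeFreeEnergy ρ W ε θ t z n) P :=
  hW.integrable_freeEnergy ρ ε _ _ _ n z

theorem integral_norm_latticeFreeEnergy_le {t : ℝ≥0} {z : Plane} {n : ℕ} {C : ℝ}
    (hC : -C ≤ ∫ ω, latticeFreeEnergy ρ W ε θ t z n ω ∂P) :
    ∫ ω, ‖latticeFreeEnergy ρ W ε θ t z n ω‖ ∂P ≤ 2 + C := by
  refine (integral_norm_le_two_mul_integral_exp_sub (hW.integrable_latticeFreeEnergy ρ ε θ t z n)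
    (hW.integrable_exp_freeEnergy ρ ε _ _ _ n z)).trans ?_
  simp only [latticeFreeEnergy, hW.integral_exp_freeEnergy] at hC ⊢
  linarith

theorem eventually_integral_norm_latticeFreeEnergy_le (hε : ε ∈ Set.Ioo (0 : ℝ) 1) (hθ : 0 ≤ θ)
    (t : ℝ≥0) (z : Plane) :
    ∀ᶠ n in atTop, ∫ ω, ‖latticeFreeEnergy ρ W ε θ t z n ω‖ ∂P ≤
      2 + coupling ε * renormalization ρ ε θ t := by
  filter_upwards [eventually_ne_atTop 0] with n hn
  refine hW.integral_norm_latticeFreeEnergy_le ?_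
  rw [← half_variance_eq hε hθ t hn]
  exact hW.neg_half_variance_le_integral_freeEnergy ρ ε _ _ _ n z

end IsCylindricalWiener

namespace IsSolution

variable (hW : IsCylindricalWiener W P) (hsol : IsSolution ρ W P ε θ h)
  (hε : ε ∈ Set.Ioo (0 : ℝ) 1) (hθ : 0 ≤ θ) (t : ℝ≥0)
include hW hsol hε hθ

theorem integrable (z : Plane) : Integrable (h t (toTorus z)) P := by
  have hlimit := integrable_of_ae_tendsto_of_integral_norm_le
    (hW.integrable_latticeFreeEnergy ρ ε θ t z)
    (hW.eventually_integral_norm_latticeFreeEnergy_le hε hθ t z)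
    (hsol.tendsto_latticeFreeEnergy hW hε hθ t z)
  rw [integrable_const_mul_iff (coupling_pos hε).ne'.isUnit] at hlimit
  exact (hlimit.add (integrable_const (renormalization ρ ε θ t))).congr
    (.of_forall fun ω => sub_add_cancel _ _)

theorem integral_coupling_mul_sub (z : Plane) :
    ∫ ω, coupling ε * (h t (toTorus z) ω - renormalization ρ ε θ t) ∂P =
      coupling ε * (∫ ω, h t (toTorus z) ω ∂P - renormalization ρ ε θ t) := by
  rw [integral_const_mul, integral_sub (hsol.integrable hW hε hθ t z) (integrable_const _),
    integral_const, probReal_univ, one_smul]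

theorem integral_eq (z z' : Plane) :
    ∫ ω, h t (toTorus z) ω ∂P = ∫ ω, h t (toTorus z') ω ∂P := by
  have hlaw := map_eq_of_ae_tendsto
    (fun n => (hW.integrable_latticeFreeEnergy ρ ε θ t z n).aemeasurable)
    (fun n => (hW.integrable_latticeFreeEnergy ρ ε θ t z' n).aemeasurable)
    (hsol.tendsto_latticeFreeEnergy hW hε hθ t z) (hsol.tendsto_latticeFreeEnergy hW hε hθ t z')
    fun n => hW.map_freeEnergy_eq ρ ε _ _ _ n z z'
  have hmean (z : Plane) :
      ∫ x, x ∂P.map (fun ω => coupling ε * (h t (toTorus z) ω - renormalization ρ ε θ t)) =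
        coupling ε * (∫ ω, h t (toTorus z) ω ∂P - renormalization ρ ε θ t) := by
    rw [← hsol.integral_coupling_mul_sub hW hε hθ]
    exact integral_map (((hsol.aemeasurable t _).sub_const _).const_mul _)
      aestronglyMeasurable_id
  have heq := (hmean z).symm.trans ((congrArg (fun μ => ∫ x, x ∂μ) hlaw).trans (hmean z'))
  exact sub_left_inj.1 (mul_left_cancel₀ (coupling_pos hε).ne' heq)

theorem abs_integral_sub_renormalization_le (z : Plane) {B : ℝ}
    (hB : ∀ᶠ n in atTop, ∫ ω, ‖latticeFreeEnergy ρ W ε θ t z n ω‖ ∂P ≤ B) :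
    |∫ ω, h t (toTorus z) ω ∂P - renormalization ρ ε θ t| ≤ B * |log ε| ^ (1 / 2 : ℝ) := by
  rw [abs_log_rpow_half, ← div_eq_mul_inv, le_div_iff₀' (coupling_pos hε)]
  calc coupling ε * |∫ ω, h t (toTorus z) ω ∂P - renormalization ρ ε θ t|
      = ‖∫ ω, coupling ε * (h t (toTorus z) ω - renormalization ρ ε θ t) ∂P‖ := by
        rw [hsol.integral_coupling_mul_sub hW hε hθ, norm_mul, norm_eq_abs, norm_eq_abs,
          abs_of_pos (coupling_pos hε)]
    _ ≤ ∫ ω, ‖coupling ε * (h t (toTorus z) ω - renormalization ρ ε θ t)‖ ∂P :=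
        norm_integral_le_integral_norm _
    _ ≤ B := integral_norm_le_of_ae_tendsto (hW.integrable_latticeFreeEnergy ρ ε θ t z) hB
        (hsol.tendsto_latticeFreeEnergy hW hε hθ t z)

end IsSolution

theorem eventually_abs_integral_sub_renormalization_le (hW : IsCylindricalWiener W P)
    (hθ : 0 ≤ θ) (hθ' : θ ≤ 1 / 100) {h : ℝ → ℝ≥0 → Torus → Ω → ℝ}
    (hsol : ∀ ε ∈ Set.Ioo (0 : ℝ) 1, IsSolution ρ W P ε θ (h ε)) (t : ℝ≥0) (z : Plane) :
    ∀ᶠ ε in 𝓝[>] (0 : ℝ), |∫ ω, h ε t (toTorus z) ω ∂P - renormalization ρ ε θ t| ≤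
      (2 + (exp 1 - 1) / 2 * log 2) * |log ε| ^ (1 / 2 : ℝ) := by
  filter_upwards [eventually_coupling_sq_mul_le ρ hθ hθ' t, Ioo_mem_nhdsGT one_pos]
    with ε hsmall hε
  refine (hsol ε hε).abs_integral_sub_renormalization_le hW hε hθ t z ?_
  rcases eq_zero_or_pos t with rfl | ht
  · filter_upwards [hW.eventually_integral_norm_latticeFreeEnergy_le hε hθ 0 z] with n hn
    have hpos : 0 ≤ (exp 1 - 1) / 2 * log 2 :=
      mul_nonneg (by linarith [add_one_le_exp 1]) (log_nonneg one_le_two)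
    refine hn.trans ?_
    simpa [renormalization] using hpos
  · filter_upwards [hW.eventually_neg_log_two_le_integral_latticeFreeEnergy hε hθ ht z
      (Nat.ceil_pos.2 (inv_pos.2 hε.1)) hsmall] with n hn
    exact hW.integral_norm_latticeFreeEnergy_le hn

end Solution

end KPZ

end

theorem lemma6p4 :
    ∃ θ₀ : ℝ, 0 < θ₀ ∧
      ∀ (ρ : KPZ.Mollifier) {Ω : Type*} [MeasurableSpace Ω] (P : Measure Ω)
        [IsProbabilityMeasure P]
        (W : ℝ≥0 → Lp ℝ 2 (volume : Measure KPZ.Torus) → Ω → ℝ),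
        KPZ.IsCylindricalWiener W P →
      ∀ θ : ℝ, 0 ≤ θ → θ ≤ θ₀ →
      ∀ h : ℝ → ℝ≥0 → KPZ.Torus → Ω → ℝ,
        (∀ ε ∈ Set.Ioo (0 : ℝ) 1, KPZ.IsSolution ρ W P ε θ (h ε)) →
      -- the renormalization constant `κ^ε_θ(t) = 𝐄 h(t, x)` is well defined, free of `x`
      ∃ κ : ℝ → ℝ≥0 → ℝ,
        (∀ ε ∈ Set.Ioo (0 : ℝ) 1, ∀ t x,
          Integrable (h ε t x) P ∧ ∫ ω, h ε t x ω ∂P = κ ε t) ∧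
        ∀ t : ℝ≥0,
          (fun ε : ℝ => κ ε t -
              1 / 2 * |Real.log ε| ^ (-(1 / 2) : ℝ) * (θ * t / ε ^ 2) * ∫ x, ρ.toFun x ^ 2)
            =O[nhdsWithin 0 (Set.Ioi 0)] fun ε : ℝ => |Real.log ε| ^ (1 / 2 : ℝ) := by
  refine ⟨1 / 100, by norm_num, ?_⟩
  intro ρ Ω _ P _ W hW θ hθ hθ' h hsol
  refine ⟨fun ε t => ∫ ω, h ε t (KPZ.toTorus 0) ω ∂P, fun ε hε t x => ?_, fun t => ?_⟩
  · rw [← KPZ.toTorus_cellRep x]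
    exact ⟨(hsol ε hε).integrable hW hε hθ t _, (hsol ε hε).integral_eq hW hε hθ t _ _⟩
  · refine Asymptotics.IsBigO.of_bound (2 + (Real.exp 1 - 1) / 2 * Real.log 2) ?_
    filter_upwards [KPZ.eventually_abs_integral_sub_renormalization_le hW hθ hθ' hsol t 0]
      with ε hε
    rwa [Real.norm_of_nonneg (Real.rpow_nonneg (abs_nonneg _) _)]
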